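/- Let $\{\Theta(k)\}_{k\ge 0}$ be a bounded sequence of complex numbers, let $\upsilon\in\mathbb{C}$ with $\operatorname{Re}(\upsilon)>0$, and let $c>0$, $y>0$ and $\lambda,b$ be real numbers with either $\lambda>0,\ b>0$ or $\lambda<0,\ b<0$. Write $(a)_n=a(a+1)\cdots(a+n-1)$, $(a)_0=1$, for the Pochhammer symbol, $$ {}_2F_3\left(\begin{matrix}\alpha_1,\alpha_2\\ \beta_1,\beta_2,\beta_3\end{matrix};z\right)=\sum_{n=0}^{\infty}\frac{(\alpha_1)_n(\alpha_2)_n}{(\beta_1)_n(\beta_2)_n(\beta_3)_n}\frac{z^n}{n!}, $$ $\Delta(2;a)$ for the pair $\frac a2,\frac{a+1}2$, and, for $j\in\{0,1,2,3\}$, $\Delta^*(4;1+j)$ for the three parameters that remain of $\frac{j+1}4,\frac{j+2}4,\frac{j+3}4,\frac{j+4}4$ when the parameter $\frac44$ is omitted. Put $$ \rho_k=\frac{\left(\frac{\lambda b+c}{c}\right)_k}{\left(\frac{\lambda b}{c}\right)_k},\qquad z_k=-\frac{(\lambda b\,\rho_k)^4}{64y^2}\qquad(k=0,1,2,\dots),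 $$ and $$ I^*_C=\sum_{k=0}^{\infty}\frac{\Theta(k)}{k!}\int_0^\infty x^{\upsilon-1}e^{-(\lambda b+ck)\sqrt{x}}\cos(xy)\,dx . $$ Then $\lambda b\,\rho_k=\lambda b+ck$ for all $k$ (so that $z_k=-(\lambda b+ck)^4/(64y^2)$), all the integrals in $I^*_C$ converge absolutely, the series for $I^*_C$ and all the series below (for each fixed $k$ the series over $\ell$ and the ${}_2F_3$ series, and each of the series over $k$) converge absolutely, and $$ I^*_C=y^{-\upsilon}\sum_{k=0}^{\infty}\left[\frac{\Theta(k)}{k!}\sum_{\ell=0}^{\infty}\frac{(-1)^\ell(\lambda b+ck)^\ell\,\Gamma\left(\upsilon+\frac{\ell}{2}\right)}{y^{\ell/2}\,\ell!}\cos\left(\frac{\upsilon\pi}{2}+\frac{\ell\pi}{4}\right)\right] $$ $$ =y^{-\upsilon}\sum_{k=0}^{\infty}\left[\frac{\Theta(k)}{k!}\sum_{j=0}^{3}\frac{(-1)^j(\lambda b+ck)^j\,\Gamma\left(\upsilon+\frac j2\right)}{y^{j/2}\,j!}\cos\left(\frac{\upsilon\pi}{2}+\frac{j\pi}{4}\right){}_2F_3\left(\begin{matrix}\Delta\left(2;\frac{2\upsilon+j}{2}\right)\\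 \Delta^*(4;1+j)\end{matrix};z_k\right)\right] $$ $$ =y^{-\upsilon}\sum_{k=0}^{\infty}\left[\frac{\Theta(k)}{k!}\sum_{j=0}^{3}\frac{(-1)^j\,\Gamma\left(\upsilon+\frac j2\right)}{j!}\cos\left(\frac{\upsilon\pi}{2}+\frac{j\pi}{4}\right)\left(\frac{\lambda b}{\sqrt y}\right)^j\rho_k^{\,j}\;{}_2F_3\left(\begin{matrix}\Delta\left(2;\frac{2\upsilon+j}{2}\right)\\ \Delta^*(4;1+j)\end{matrix};z_k\right)\right] $$ $$ =\frac{\Gamma(\upsilon)\cos\left(\frac{\upsilon\pi}{2}\right)}{y^{\upsilon}}\sum_{k=0}^{\infty}\frac{\Theta(k)}{k!}\,{}_2F_3\left(\begin{matrix}\frac{\upsilon}{2},\frac{\upsilon+1}{2}\\ \frac14,\frac12,\frac34\end{matrix};z_k\right) $$ $$ -\frac{\lambda b\,\Gamma\left(\upsilon+\frac12\right)\cos\left(\frac{\upsilon\pi}{2}+\frac{\pi}{4}\right)}{y^{\upsilon+\frac12}}\sum_{k=0}^{\infty}\frac{\Theta(k)}{k!}\,\rho_k\;{}_2F_3\left(\begin{matrix}\frac{2\upsilon+1}{4},\frac{2\upsilon+3}{4}\\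 \frac12,\frac34,\frac54\end{matrix};z_k\right) $$ $$ -\frac{(\lambda b)^2\,\Gamma(\upsilon+1)\sin\left(\frac{\upsilon\pi}{2}\right)}{2y^{\upsilon+1}}\sum_{k=0}^{\infty}\frac{\Theta(k)}{k!}\,\rho_k^{2}\;{}_2F_3\left(\begin{matrix}\frac{\upsilon+1}{2},\frac{\upsilon+2}{2}\\ \frac34,\frac54,\frac32\end{matrix};z_k\right) $$ $$ +\frac{(\lambda b)^3\,\Gamma\left(\upsilon+\frac32\right)\sin\left(\frac{\upsilon\pi}{2}+\frac{\pi}{4}\right)}{6y^{\upsilon+\frac32}}\sum_{k=0}^{\infty}\frac{\Theta(k)}{k!}\,\rho_k^{3}\;{}_2F_3\left(\begin{matrix}\frac{2\upsilon+3}{4},\frac{2\upsilon+5}{4}\\ \frac54,\frac32,\frac74\end{matrix};z_k\right). $$ -/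

import Mathlib

noncomputable section

/-- The Pochhammer symbol `(a)_n = a (a + 1) ⋯ (a + n - 1)`, with `(a)_0 = 1`. -/
def poch (a : ℂ) (n : ℕ) : ℂ := (ascPochhammer ℂ n).eval a

/-- The `n`-th term of the generalized hypergeometric series with numerator parameters `as`
and denominator parameters `bs`. -/
def pFqTerm (as bs : List ℂ) (z : ℂ) (n : ℕ) : ℂ :=
  (as.map fun a => poch a n).prod / (bs.map fun b => poch b n).prod *
    (z ^ n / (n.factorial : ℂ))

/-- The generalized hypergeometric function `pFq(as; bs; z)`. -/
def pFq (as bs : List ℂ) (z : ℂ) : ℂ := ∑' n : ℕ, pFqTerm as bs z n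

/-- `Δ(N; a)`: the array of `N` parameters `a/N, (a+1)/N, …, (a+N-1)/N`. -/
def paramDelta (N : ℕ) (a : ℂ) : List ℂ :=
  (List.range N).map fun i => (a + (i : ℂ)) / (N : ℂ)

/-- `Δ*(N; s)`: the array `s/N, (s+1)/N, …, (s+N-1)/N` from which the parameter `N/N` is omitted. -/
def paramDeltaStar (N s : ℕ) : List ℂ :=
  ((List.range N).filter fun i => s + i ≠ N).map fun i => ((s + i : ℕ) : ℂ) / (N : ℂ)

/-- The integrand `x^(υ-1) e^{-(lam b + c k) √x} cos (x y)`. -/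
def cosIntegrand (υ : ℂ) (b c lam y : ℝ) (k : ℕ) (x : ℝ) : ℂ :=
  (x : ℂ) ^ (υ - 1) * ((Real.exp (-(lam * b + c * k) * √x) : ℝ) : ℂ) * ((Real.cos (x * y) : ℝ) : ℂ)

/-- The `k`-th term `Θ(k)/k! ∫_0^∞ x^(υ-1) e^{-(lam b + c k) √x} cos (x y) dx` of `I*_C`. -/
def IStarCTerm (Θ : ℕ → ℂ) (υ : ℂ) (b c lam y : ℝ) (k : ℕ) : ℂ :=
  Θ k / (k.factorial : ℂ) * ∫ x in Set.Ioi (0 : ℝ), cosIntegrand υ b c lam y k x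

/-- `I*_C(υ, b, c, lam, y)`. -/
def IStarC (Θ : ℕ → ℂ) (υ : ℂ) (b c lam y : ℝ) : ℂ :=
  ∑' k : ℕ, IStarCTerm Θ υ b c lam y k

/-- The `ℓ`-th term of the inner series of the double series for `I*_C`. -/
def doubleTerm (υ : ℂ) (b c lam y : ℝ) (k ℓ : ℕ) : ℂ :=
  (-1) ^ ℓ * ((lam * b + c * k : ℝ) : ℂ) ^ ℓ * Complex.Gamma (υ + (ℓ : ℂ) / 2) /
      (((y ^ ((ℓ : ℝ) / 2) : ℝ) : ℂ) * (ℓ.factorial : ℂ)) *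
    Complex.cos (υ * (Real.pi : ℂ) / 2 + (ℓ : ℂ) * (Real.pi : ℂ) / 4)

/-- The ratio of Pochhammer symbols `((lam b + c)/c)_k / (lam b/c)_k`. -/
def pochRatio (b c lam : ℝ) (k : ℕ) : ℂ :=
  poch (((lam * b + c) / c : ℝ) : ℂ) k / poch ((lam * b / c : ℝ) : ℂ) k

/-- The argument `-(1/(64 y²)) {lam b ((lam b + c)/c)_k / (lam b/c)_k}^4`. -/
def hypArg (b c lam y : ℝ) (k : ℕ) : ℂ :=
  (-1) / (64 * (y : ℂ) ^ 2) * (((lam * b : ℝ) : ℂ) * pochRatio b c lam k) ^ 4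

end

open Filter Topology MeasureTheory

/-! Write a = λb + ck. Expanding e^{-a√x} and integrating termwise against x^{υ-1} e^{-px} gives ∑
(-a)^ℓ/ℓ! Γ(υ+ℓ/2) p^{-(υ+ℓ/2)}. For Re p > 0 the interchange is absolutely justified
(`integral_cpow_mul_exp_neg_sqrt_mul_exp`). At p = ±iy it is not, so p tends to the imaginary axis
from the right, with dominated convergence on both sides
(`integral_cpow_mul_exp_neg_sqrt_mul_exp_imaginary`). Averaging p = iy and p = -iy produces the
coefficients (-1)^ℓ cos(υπ/2 + ℓπ/4).

These coefficients change sign under ℓ ↦ ℓ + 4, so the series splits by residues mod 4. Each class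
is a constant times r^j times a 2F3 at -r⁴/64, where r = a/√y (`gammaSeries_residueCoeff`).

The delicate point is convergence over k of each of the four pieces. Bounding terms by absolute
values only gives growth like e^{r²/4} with r linear in k, which 1/k! does not absorb. The sign
change makes each piece part of a linear differential system whose energy grows at most
exponentially (`exists_norm_gammaSeries_le`), and this suffices. -/

/-- If each term is at most `C / (n + 1)` times the term two places earlier, the series converges. -/
theorem summable_of_norm_add_two_le {f : ℕ → ℂ} (C : ℝ)
    (h : ∀ n, ‖f (n + 2)‖ ≤ C / (n + 1) * ‖f n‖) : Summable f := by
  have hlim : Tendsto (fun n : ℕ => C / ((n : ℝ) + 1)) atTop (𝓝 0) :=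
    tendsto_const_nhds.div_atTop (tendsto_atTop_add_const_right _ _ tendsto_natCast_atTop_atTop)
  have hev : ∀ᶠ n : ℕ in atTop, C / ((n : ℝ) + 1) ≤ 1 / 2 :=
    (hlim.eventually (gt_mem_nhds (by norm_num : (0 : ℝ) < 1 / 2))).mono fun _ => le_of_lt
  -- The ratio test is applied separately to the even and the odd terms.
  have key : ∀ i : ℕ, Summable fun n => f (2 * n + i) := by
    intro i
    refine summable_of_ratio_norm_eventually_le (r := 1 / 2) (by norm_num) ?_
    have ht : Tendsto (fun n : ℕ => 2 * n + i) atTop atTop :=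
      tendsto_atTop_mono (fun n => by simp only [id]; omega) tendsto_id
    filter_upwards [ht.eventually hev] with n hn
    have := h (2 * n + i)
    rw [show 2 * (n + 1) + i = 2 * n + i + 2 by ring]
    exact this.trans (mul_le_mul_of_nonneg_right hn (norm_nonneg _))
  exact ((key 0).hasSum.even_add_odd (key 1).hasSum).summable

/-! ### Series with Gamma coefficients: convergence, derivative, growth -/

/-- The `ℓ`-th term of `∑ c_ℓ Γ(υ + ℓ/2) r^ℓ / ℓ!`. -/
noncomputable def gammaTerm (υ : ℂ) (c : ℕ → ℂ) (r : ℝ) (ℓ : ℕ) : ℂ :=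
  c ℓ * Complex.Gamma (υ + (ℓ : ℂ) / 2) * ((r : ℂ) ^ ℓ / (ℓ.factorial : ℂ))

/-- The series `∑ c_ℓ Γ(υ + ℓ/2) r^ℓ / ℓ!`. -/
noncomputable def gammaSeries (υ : ℂ) (c : ℕ → ℂ) (r : ℝ) : ℂ := ∑' ℓ : ℕ, gammaTerm υ c r ℓ

theorem add_natCast_half_ne_zero {υ : ℂ} (hυ : 0 < υ.re) (ℓ : ℕ) : υ + (ℓ : ℂ) / 2 ≠ 0 := by
  intro h
  have := congrArg Complex.re h
  simp at this
  have : (0 : ℝ) ≤ (ℓ : ℝ) / 2 := by positivity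
  have h2 : ((ℓ : ℂ) / 2).re = (ℓ : ℝ) / 2 := by simp
  linarith

theorem Gamma_add_half_natCast_add_two {υ : ℂ} (hυ : 0 < υ.re) (ℓ : ℕ) :
    Complex.Gamma (υ + ((ℓ + 2 : ℕ) : ℂ) / 2) =
      (υ + (ℓ : ℂ) / 2) * Complex.Gamma (υ + (ℓ : ℂ) / 2) := by
  rw [← Complex.Gamma_add_one _ (add_natCast_half_ne_zero hυ ℓ)]
  congr 1; push_cast; ring

/-- The Gamma recurrence moves its argument by 1, hence ℓ by 2. Over two steps Γ gains a factor
linear in ℓ and the factorial a quadratic one. -/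
theorem summable_norm_gammaTerm {υ : ℂ} (hυ : 0 < υ.re) {c : ℕ → ℂ} {M : ℝ}
    (hc : ∀ ℓ, ‖c ℓ‖ ≤ M) (r : ℝ) : Summable fun ℓ => ‖gammaTerm υ c r ℓ‖ := by
  have h1 : Summable (gammaTerm υ (fun _ => 1) r) := by
    refine summable_of_norm_add_two_le ((‖υ‖ + 1) * r ^ 2) fun n => ?_
    unfold gammaTerm
    rw [Gamma_add_half_natCast_add_two hυ, Nat.factorial_succ, Nat.factorial_succ]
    have e : (1 : ℂ) * ((υ + (n : ℂ) / 2) * Complex.Gamma (υ + (n : ℂ) / 2)) *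
        ((r : ℂ) ^ (n + 2) / (((n + 1 + 1) * ((n + 1) * n.factorial) : ℕ) : ℂ)) =
        ((υ + (n : ℂ) / 2) * ((r : ℂ) ^ 2 / (((n : ℂ) + 2) * ((n : ℂ) + 1)))) *
        (1 * Complex.Gamma (υ + (n : ℂ) / 2) * ((r : ℂ) ^ n / (n.factorial : ℂ))) := by
      have h3 : ((n : ℂ) + 1) ≠ 0 := Nat.cast_add_one_ne_zero n
      have h4 : ((n : ℂ) + 2) ≠ 0 := by exact_mod_cast (by omega : n + 2 ≠ 0)
      have h5 : (n.factorial : ℂ) ≠ 0 := by exact_mod_cast n.factorial_ne_zero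
      have h6 : ((n : ℂ) + 1 + 1) ≠ 0 := by exact_mod_cast (by omega : n + 1 + 1 ≠ 0)
      push_cast
      field_simp
      ring
    rw [e, norm_mul]
    refine mul_le_mul_of_nonneg_right ?_ (norm_nonneg _)
    rw [norm_mul, norm_div, norm_mul, norm_pow, Complex.norm_real, Real.norm_eq_abs, sq_abs]
    have n1 : ‖(n : ℂ) + 1‖ = (n : ℝ) + 1 := by
      exact_mod_cast Complex.norm_natCast (n + 1)
    have n2 : ‖(n : ℂ) + 2‖ = (n : ℝ) + 2 := by
      exact_mod_cast Complex.norm_natCast (n + 2)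
    rw [n1, n2]
    have n3 : ‖υ + (n : ℂ) / 2‖ ≤ (‖υ‖ + 1) * (n + 2) := by
      refine (norm_add_le _ _).trans ?_
      have : ‖(n : ℂ) / 2‖ = (n : ℝ) / 2 := by simp
      rw [this]
      have := norm_nonneg υ
      have hn : (0 : ℝ) ≤ n := n.cast_nonneg
      nlinarith [mul_nonneg this hn]
    calc _ ≤ ((‖υ‖ + 1) * (n + 2)) * (r ^ 2 / (((n : ℝ) + 2) * (n + 1))) := by gcongr
      _ = _ := by field_simp
  refine Summable.of_nonneg_of_le (fun _ => norm_nonneg _) (fun ℓ => ?_) (h1.norm.mul_left M)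
  have : gammaTerm υ c r ℓ = c ℓ * gammaTerm υ (fun _ => 1) r ℓ := by unfold gammaTerm; ring
  rw [this, norm_mul]
  exact mul_le_mul_of_nonneg_right (hc ℓ) (norm_nonneg _)

/-- Γ(s+1) = sΓ(s) with s = υ + ℓ/2: the part ℓ/2 cancels against ℓ! and shifts the index. It closes
the differential system satisfied by the series and its shifts. -/
theorem gammaSeries_add_one {υ : ℂ} (hυ : 0 < υ.re) {c : ℕ → ℂ} {M : ℝ}
    (hc : ∀ ℓ, ‖c ℓ‖ ≤ M) (r : ℝ) :
    gammaSeries (υ + 1) c r =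
      υ * gammaSeries υ c r + (r / 2 : ℂ) * gammaSeries (υ + 1 / 2) (fun ℓ => c (ℓ + 1)) r := by
  have hs := (summable_norm_gammaTerm hυ hc r).of_norm
  have hυ' : 0 < (υ + 1 / 2).re := by simp; linarith
  have hs' := (summable_norm_gammaTerm hυ' (c := fun ℓ => c (ℓ + 1)) (fun ℓ => hc (ℓ + 1)) r).of_norm
  have hυ'' : 0 < (υ + 1).re := by simp; linarith
  have hs'' := (summable_norm_gammaTerm hυ'' hc r).of_norm
  have hd : Summable fun ℓ => gammaTerm (υ + 1) c r ℓ - υ * gammaTerm υ c r ℓ :=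
    hs''.sub (hs.mul_left υ)
  have e0 : ∀ ℓ : ℕ, gammaTerm (υ + 1) c r ℓ - υ * gammaTerm υ c r ℓ =
      (ℓ : ℂ) / 2 * gammaTerm υ c r ℓ := by
    intro ℓ
    unfold gammaTerm
    rw [show υ + 1 + (ℓ : ℂ) / 2 = υ + (ℓ : ℂ) / 2 + 1 by ring,
      Complex.Gamma_add_one _ (add_natCast_half_ne_zero hυ ℓ)]
    ring
  have key : gammaSeries (υ + 1) c r - υ * gammaSeries υ c r =
      (r / 2 : ℂ) * gammaSeries (υ + 1 / 2) (fun ℓ => c (ℓ + 1)) r := by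
    unfold gammaSeries
    rw [← tsum_mul_left, ← hs''.tsum_sub (hs.mul_left υ), hd.tsum_eq_zero_add, e0 0,
      ← tsum_mul_left]
    simp only [Nat.cast_zero, zero_div, zero_mul, zero_add]
    refine tsum_congr fun ℓ => ?_
    rw [e0]
    unfold gammaTerm
    have h3 : ((ℓ : ℂ) + 1) ≠ 0 := Nat.cast_add_one_ne_zero ℓ
    have h5 : (ℓ.factorial : ℂ) ≠ 0 := by exact_mod_cast ℓ.factorial_ne_zero
    rw [Nat.factorial_succ, show υ + 1 / 2 + (ℓ : ℂ) / 2 = υ + ((ℓ + 1 : ℕ) : ℂ) / 2 by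
      push_cast; ring]
    push_cast
    field_simp
    ring
  rw [← key]; ring

theorem hasDerivAt_gammaSeries {υ : ℂ} (hυ : 0 < υ.re) {c : ℕ → ℂ} {M : ℝ}
    (hc : ∀ ℓ, ‖c ℓ‖ ≤ M) (r : ℝ) :
    HasDerivAt (gammaSeries υ c) (gammaSeries (υ + 1 / 2) (fun ℓ => c (ℓ + 1)) r) r := by
  set R : ℝ := |r| + 1
  have hυ' : 0 < (υ + 1 / 2).re := by simp; linarith
  have hs' := summable_norm_gammaTerm hυ' (c := fun ℓ => c (ℓ + 1)) (fun ℓ => hc (ℓ + 1))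
  -- Termwise derivative. At ℓ = 0 the truncated exponent ℓ - 1 is harmless because of the factor ℓ.
  let D : ℕ → ℝ → ℂ := fun ℓ x =>
    c ℓ * Complex.Gamma (υ + (ℓ : ℂ) / 2) * ((ℓ : ℂ) * (x : ℂ) ^ (ℓ - 1) / (ℓ.factorial : ℂ))
  have hD1 : ∀ ℓ x, D (ℓ + 1) x = gammaTerm (υ + 1 / 2) (fun ℓ => c (ℓ + 1)) x ℓ := by
    intro ℓ x
    simp only [D]
    unfold gammaTerm
    have h3 : ((ℓ : ℂ) + 1) ≠ 0 := Nat.cast_add_one_ne_zero ℓ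
    have h5 : (ℓ.factorial : ℂ) ≠ 0 := by exact_mod_cast ℓ.factorial_ne_zero
    rw [Nat.factorial_succ, show υ + 1 / 2 + (ℓ : ℂ) / 2 = υ + ((ℓ + 1 : ℕ) : ℂ) / 2 by
      push_cast; ring]
    push_cast
    field_simp
  have hD0 : ∀ x, D 0 x = 0 := fun x => by simp [D]
  have hsumD : ∀ x, Summable fun ℓ => ‖D ℓ x‖ := fun x => by
    rw [← summable_nat_add_iff 1]
    simpa only [hD1] using hs' x
  have hmono : ∀ (ℓ : ℕ) (x : ℝ), x ∈ Metric.ball (0 : ℝ) R → ‖D ℓ x‖ ≤ ‖D ℓ R‖ := by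
    intro ℓ x hx
    have hx' : |x| ≤ |R| := by
      rw [mem_ball_zero_iff, Real.norm_eq_abs] at hx
      exact hx.le.trans (le_abs_self R)
    simp only [D, norm_mul, norm_div, norm_pow, Complex.norm_real, Real.norm_eq_abs]
    gcongr
  have hr : r ∈ Metric.ball (0 : ℝ) R := by
    rw [mem_ball_zero_iff, Real.norm_eq_abs]; simp [R]
  have := hasDerivAt_tsum_of_isPreconnected (𝕜 := ℝ) (g := fun ℓ x => gammaTerm υ c x ℓ) (g' := D)
    (u := fun ℓ => ‖D ℓ R‖) (t := Metric.ball (0 : ℝ) R) (y₀ := r) (y := r) (hsumD R)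
    Metric.isOpen_ball (convex_ball (0 : ℝ) R).isPreconnected
    (fun ℓ x _ => by
      have h1 : HasDerivAt (fun z : ℂ => z ^ ℓ) ((ℓ : ℂ) * (x : ℂ) ^ (ℓ - 1)) (x : ℂ) :=
        hasDerivAt_pow ℓ (x : ℂ)
      exact ((h1.comp_ofReal.div_const _).const_mul _)) hmono hr
    (summable_norm_gammaTerm hυ hc r).of_norm hr
  have e : ∑' ℓ, D ℓ r = gammaSeries (υ + 1 / 2) (fun ℓ => c (ℓ + 1)) r := by
    rw [(hsumD r).of_norm.tsum_eq_zero_add, hD0, zero_add]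
    simp only [hD1]
    rfl
  rw [← e]
  exact this

/-- A gamma series whose coefficients change sign with every shift by four places grows at most
exponentially on the positive half-line. -/
theorem exists_norm_gammaSeries_le {υ : ℂ} (hυ : 0 < υ.re) {c : ℕ → ℂ} {M : ℝ}
    (hc : ∀ ℓ, ‖c ℓ‖ ≤ M) (h4 : ∀ ℓ, c (ℓ + 4) = -c ℓ) :
    ∃ A B : ℝ, 0 ≤ A ∧ ∀ r : ℝ, 0 ≤ r → ‖gammaSeries υ c r‖ ≤ A * Real.exp (B * r) := by
  -- With h the series shifted by two places, antiperiodicity closes the system: g' = g1, h' = h1,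
  -- g1' = υh + (r/2)h1, h1' = -(υg + (r/2)g1).
  have hυ' : 0 < (υ + 1 / 2).re := by simp; linarith
  set g := gammaSeries υ c
  set g1 := gammaSeries (υ + 1 / 2) (fun ℓ => c (ℓ + 1))
  set h := gammaSeries υ (fun ℓ => c (ℓ + 2))
  set h1 := gammaSeries (υ + 1 / 2) (fun ℓ => c (ℓ + 3))
  have dg : ∀ r, HasDerivAt g (g1 r) r := fun r => hasDerivAt_gammaSeries hυ hc r
  have dh : ∀ r, HasDerivAt h (h1 r) r := fun r =>
    hasDerivAt_gammaSeries hυ (c := fun ℓ => c (ℓ + 2)) (fun ℓ => hc (ℓ + 2)) r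
  have dg1 : ∀ r, HasDerivAt g1 (υ * h r + (r / 2 : ℂ) * h1 r) r := fun r => by
    have := hasDerivAt_gammaSeries hυ' (c := fun ℓ => c (ℓ + 1)) (fun ℓ => hc (ℓ + 1)) r
    rw [show υ + 1 / 2 + 1 / 2 = υ + 1 by ring,
      gammaSeries_add_one hυ (c := fun ℓ => c (ℓ + 1 + 1)) (fun ℓ => hc (ℓ + 1 + 1)) r] at this
    exact this
  have dh1 : ∀ r, HasDerivAt h1 (-(υ * g r + (r / 2 : ℂ) * g1 r)) r := fun r => by
    have := hasDerivAt_gammaSeries hυ' (c := fun ℓ => c (ℓ + 3)) (fun ℓ => hc (ℓ + 3)) r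
    rw [show υ + 1 / 2 + 1 / 2 = υ + 1 by ring] at this
    convert this using 1
    rw [← gammaSeries_add_one hυ hc r]
    unfold gammaSeries
    rw [← tsum_neg]
    refine tsum_congr fun ℓ => ?_
    simp only [gammaTerm, show ℓ + 1 + 3 = ℓ + 4 by ring, h4]
    ring
  set K : ℝ := 1 + ‖υ‖
  let E : ℝ → ℝ := fun r => ‖g r‖ ^ 2 + ‖h r‖ ^ 2 + ‖g1 r‖ ^ 2 + ‖h1 r‖ ^ 2
  let E' : ℝ → ℝ := fun r => 2 * inner ℝ (g r) (g1 r) + 2 * inner ℝ (h r) (h1 r) +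
    2 * inner ℝ (g1 r) (υ * h r + (r / 2 : ℂ) * h1 r) +
    2 * inner ℝ (h1 r) (-(υ * g r + (r / 2 : ℂ) * g1 r))
  have dE : ∀ r, HasDerivAt E (E' r) r := fun r =>
    (((dg r).norm_sq.add (dh r).norm_sq).add (dg1 r).norm_sq).add (dh1 r).norm_sq
  have two_inner : ∀ z w : ℂ, 2 * inner ℝ z w ≤ ‖z‖ ^ 2 + ‖w‖ ^ 2 := fun z w => by
    have := real_inner_le_norm z w
    nlinarith [sq_nonneg (‖z‖ - ‖w‖)]
  have two_inner' : ∀ z w : ℂ, 2 * inner ℝ z (υ * w) ≤ ‖υ‖ * (‖z‖ ^ 2 + ‖w‖ ^ 2) := fun z w => by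
    have := real_inner_le_norm z (υ * w)
    rw [norm_mul] at this
    nlinarith [mul_nonneg (norm_nonneg υ) (sq_nonneg (‖z‖ - ‖w‖))]
  have hE' : ∀ r, E' r ≤ K * E r := fun r => by
    -- The terms with the unbounded factor r/2 form a rotation of (g1, h1) and cancel in the energy.
    -- Only bounded coefficients remain, whence the constant K = 1 + ‖υ‖.
    have hrot : inner ℝ (h1 r) ((r / 2 : ℂ) * g1 r) = inner ℝ (g1 r) ((r / 2 : ℂ) * h1 r) := by
      rw [show (r / 2 : ℂ) = ((r / 2 : ℝ) : ℂ) by push_cast; rfl, ← Complex.real_smul,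
        ← Complex.real_smul, real_inner_smul_right, real_inner_smul_right, real_inner_comm]
    have e : E' r = 2 * inner ℝ (g r) (g1 r) + 2 * inner ℝ (h r) (h1 r) +
        2 * inner ℝ (g1 r) (υ * h r) + 2 * inner ℝ (h1 r) (υ * (-g r)) := by
      simp only [E', inner_add_right, inner_neg_right, hrot, mul_neg]
      ring
    rw [e]
    have i1 := two_inner (g r) (g1 r)
    have i2 := two_inner (h r) (h1 r)
    have i3 := two_inner' (g1 r) (h r)
    have i4 := two_inner' (h1 r) (-g r)
    rw [norm_neg] at i4
    simp only [K, E]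
    nlinarith
  -- Grönwall's argument for E' ≤ K E.
  have hanti : Antitone fun r => E r * Real.exp (-(K * r)) := by
    have hd : ∀ r, HasDerivAt (fun r => E r * Real.exp (-(K * r)))
        (E' r * Real.exp (-(K * r)) + E r * (Real.exp (-(K * r)) * -(K * 1))) r := fun r =>
      (dE r).mul (((hasDerivAt_id r).const_mul K).neg.exp)
    refine antitone_of_deriv_nonpos (fun r => (hd r).differentiableAt) fun r => ?_
    rw [(hd r).deriv]
    have := mul_nonneg (sub_nonneg.2 (hE' r)) (Real.exp_pos (-(K * r))).le
    nlinarith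
  have hbound : ∀ r, 0 ≤ r → ‖g r‖ ^ 2 ≤ E 0 * Real.exp (K * r) := fun r hr => by
    have := hanti hr
    simp only [mul_zero, neg_zero, Real.exp_zero, mul_one] at this
    rw [Real.exp_neg, ← div_eq_mul_inv, div_le_iff₀ (Real.exp_pos _)] at this
    refine le_trans ?_ this
    simp only [E]
    nlinarith [sq_nonneg ‖h r‖, sq_nonneg ‖g1 r‖, sq_nonneg ‖h1 r‖]
  refine ⟨√(E 0), K / 2, Real.sqrt_nonneg _, fun r hr => ?_⟩
  refine abs_le_of_sq_le_sq' ?_ (by positivity) |>.2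
  rw [mul_pow, Real.sq_sqrt (by simp only [E]; positivity), ← Real.exp_nat_mul]
  rw [show ((2 : ℕ) : ℝ) * (K / 2 * r) = K * r by push_cast; ring]
  exact hbound r hr

/-! ### Laplace transform of a power in the right half-plane -/

theorem integrableOn_rpow_mul_exp_neg_mul {s b : ℝ} (hs : 0 < s) (hb : 0 < b) :
    IntegrableOn (fun x : ℝ => x ^ (s - 1) * Real.exp (-b * x)) (Set.Ioi 0) := by
  simpa only [Real.rpow_one] using
    integrableOn_rpow_mul_exp_neg_mul_rpow (p := 1) (by linarith : -1 < s - 1) one_pos hb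

theorem norm_cpow_mul_exp_neg_mul {s p : ℂ} {x : ℝ} (hx : 0 < x) :
    ‖(x : ℂ) ^ (s - 1) * Complex.exp (-(p * x))‖ = x ^ (s.re - 1) * Real.exp (-p.re * x) := by
  rw [norm_mul, Complex.norm_cpow_eq_rpow_re_of_pos hx, Complex.norm_exp]
  simp

theorem integrableOn_cpow_mul_exp_neg_mul {s p : ℂ} (hs : 0 < s.re) (hp : 0 < p.re) :
    IntegrableOn (fun x : ℝ => (x : ℂ) ^ (s - 1) * Complex.exp (-(p * x))) (Set.Ioi 0) := by
  refine Integrable.mono' (integrableOn_rpow_mul_exp_neg_mul hs hp) ?_ ?_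
  · exact ((Complex.measurable_ofReal.pow_const (s - 1)).mul (by fun_prop)).aestronglyMeasurable
  · exact (ae_restrict_mem measurableSet_Ioi).mono fun x hx => (norm_cpow_mul_exp_neg_mul hx).le

theorem differentiableAt_integral_cpow_mul_exp_neg_mul {s p : ℂ} (hs : 0 < s.re) (hp : 0 < p.re) :
    DifferentiableAt ℂ (fun q : ℂ => ∫ x in Set.Ioi (0 : ℝ),
      (x : ℂ) ^ (s - 1) * Complex.exp (-(q * x))) p := by
  have hb : 0 < p.re / 2 := by linarith
  have hmeas : ∀ q : ℂ, Measurable fun x : ℝ => (x : ℂ) ^ (s - 1) * Complex.exp (-(q * x)) :=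
    fun q => (Complex.measurable_ofReal.pow_const (s - 1)).mul (by fun_prop)
  refine (hasDerivAt_integral_of_dominated_loc_of_deriv_le (μ := volume.restrict (Set.Ioi 0))
    (F := fun (q : ℂ) (x : ℝ) => (x : ℂ) ^ (s - 1) * Complex.exp (-(q * x)))
    (F' := fun (q : ℂ) (x : ℝ) => (x : ℂ) ^ (s - 1) * (Complex.exp (-(q * x)) * (-(1 * (x : ℂ)))))
    (bound := fun x : ℝ => x ^ ((s.re + 1) - 1) * Real.exp (-(p.re / 2) * x))
    -- On the ball of radius Re p / 2 one has Re q ≥ Re p / 2, so a single integrable function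
    -- dominates the derivative.
    (Metric.ball_mem_nhds p hb) (Eventually.of_forall fun q => (hmeas q).aestronglyMeasurable)
    (integrableOn_cpow_mul_exp_neg_mul hs hp) ?_ ?_
    (integrableOn_rpow_mul_exp_neg_mul (by linarith) hb) ?_).2.differentiableAt
  · exact ((Complex.measurable_ofReal.pow_const (s - 1)).mul (by fun_prop)).aestronglyMeasurable
  · refine (ae_restrict_mem measurableSet_Ioi).mono fun x hx q hq => ?_
    have hx : 0 < x := hx
    have hq' : p.re / 2 ≤ q.re := by
      have h1 := (Complex.abs_re_le_norm (q - p)).trans_lt (mem_ball_iff_norm.1 hq)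
      rw [Complex.sub_re] at h1
      linarith [(abs_lt.1 h1).1]
    rw [← mul_assoc, norm_mul, norm_cpow_mul_exp_neg_mul hx, norm_neg, one_mul, Complex.norm_real,
      Real.norm_of_nonneg hx.le, mul_right_comm, ← Real.rpow_add_one hx.ne',
      show s.re - 1 + 1 = s.re + 1 - 1 by ring]
    gcongr
  · refine Eventually.of_forall fun x q _ => ?_
    exact (((hasDerivAt_id q).mul_const (x : ℂ)).neg.cexp).const_mul _

/-- The Laplace transform of `x ^ (s - 1)` at a complex point of the right half-plane. -/
theorem integral_cpow_mul_exp_neg_complex_mul {s p : ℂ} (hs : 0 < s.re) (hp : 0 < p.re) :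
    ∫ x in Set.Ioi (0 : ℝ), (x : ℂ) ^ (s - 1) * Complex.exp (-(p * x)) =
      (1 / p) ^ s * Complex.Gamma s := by
  have hopen : IsOpen {q : ℂ | 0 < q.re} := isOpen_lt continuous_const Complex.continuous_re
  have hconn : IsPreconnected {q : ℂ | 0 < q.re} := (convex_halfSpace_re_gt 0).isPreconnected
  have h1 : AnalyticOnNhd ℂ (fun q : ℂ => ∫ x in Set.Ioi (0 : ℝ),
      (x : ℂ) ^ (s - 1) * Complex.exp (-(q * x))) {q : ℂ | 0 < q.re} :=
    DifferentiableOn.analyticOnNhd (fun q hq =>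
      (differentiableAt_integral_cpow_mul_exp_neg_mul hs hq).differentiableWithinAt) hopen
  have h2 : AnalyticOnNhd ℂ (fun q : ℂ => (1 / q) ^ s * Complex.Gamma s) {q : ℂ | 0 < q.re} := by
    refine DifferentiableOn.analyticOnNhd (fun q hq => ?_) hopen
    have hq : 0 < q.re := hq
    have hq0 : q ≠ 0 := fun h => by simp [h] at hq
    refine DifferentiableAt.differentiableWithinAt (DifferentiableAt.mul_const ?_ _)
    refine DifferentiableAt.cpow_const ((differentiableAt_const _).div differentiableAt_id hq0) ?_
    left
    simp only [one_div, Complex.inv_re]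
    exact div_pos hq (Complex.normSq_pos.2 hq0)
  -- Identity theorem: both sides are analytic on the half-plane and agree at the real points 1 +
  -- 1/(n+1), which accumulate at 1.
  refine h1.eqOn_of_preconnected_of_frequently_eq h2 hconn (z₀ := 1) (by simp) ?_ hp
  have hreal : ∀ r : ℝ, 0 < r → (∫ x in Set.Ioi (0 : ℝ),
      (x : ℂ) ^ (s - 1) * Complex.exp (-((r : ℂ) * x))) = (1 / (r : ℂ)) ^ s * Complex.Gamma s :=
    fun r hr => Complex.integral_cpow_mul_exp_neg_mul_Ioi hs hr
  have htend : Tendsto (fun n : ℕ => ((1 + 1 / ((n : ℝ) + 1) : ℝ) : ℂ)) atTop (𝓝[≠] 1) := by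
    refine tendsto_nhdsWithin_iff.2 ⟨?_, Eventually.of_forall fun n => ?_⟩
    · have := (tendsto_one_div_add_atTop_nhds_zero_nat (𝕜 := ℝ)).const_add 1
      rw [add_zero] at this
      exact (Complex.continuous_ofReal.tendsto _).comp this
    · have : (1 + 1 / ((n : ℝ) + 1) : ℝ) ≠ 1 := by
        have : 0 < 1 / ((n : ℝ) + 1) := by positivity
        linarith
      exact fun h => this (Complex.ofReal_eq_one.1 h)
  exact htend.frequently (Eventually.of_forall fun n => hreal _ (by positivity)).frequently

/-! ### The integral with e^{-a√x}: termwise integration and passage to the imaginary axis -/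

theorem norm_one_div_cpow_le {υ : ℂ} {p : ℂ} {y : ℝ} (hυ : 0 < υ.re) (hy : 0 < y) (hp : y ≤ ‖p‖)
    (ℓ : ℕ) : ‖(1 / p) ^ (υ + (ℓ : ℂ) / 2)‖ ≤
      (1 / y) ^ υ.re * Real.exp (Real.pi * |υ.im|) * (√(1 / y)) ^ ℓ := by
  have hre : (υ + (ℓ : ℂ) / 2).re = υ.re + (1 / 2 : ℝ) * ℓ := by
    rw [show (ℓ : ℂ) / 2 = (((1 / 2 : ℝ) * (ℓ : ℝ) : ℝ) : ℂ) by push_cast; ring]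
    simp only [Complex.add_re, Complex.ofReal_re]
  have him : (υ + (ℓ : ℂ) / 2).im = υ.im := by
    rw [show (ℓ : ℂ) / 2 = (((1 / 2 : ℝ) * (ℓ : ℝ) : ℝ) : ℂ) by push_cast; ring]
    simp only [Complex.add_im, Complex.ofReal_im, add_zero]
  refine (Complex.norm_cpow_le _ _).trans ?_
  rw [hre, him, div_eq_mul_inv, ← Real.exp_neg, norm_div, norm_one]
  have h1 : (1 / ‖p‖) ^ (υ.re + (1 / 2 : ℝ) * ℓ) ≤ (1 / y) ^ υ.re * (√(1 / y)) ^ ℓ := by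
    have hy' : 0 < 1 / y := by positivity
    rw [Real.sqrt_eq_rpow, ← Real.rpow_mul_natCast hy'.le, ← Real.rpow_add hy']
    have : 1 / ‖p‖ ≤ 1 / y := one_div_le_one_div_of_le hy hp
    refine Real.rpow_le_rpow (by positivity) this (by positivity)
  have h2 : -((1 / p).arg * υ.im) ≤ Real.pi * |υ.im| := by
    refine (neg_le_abs _).trans ?_
    rw [abs_mul]
    exact mul_le_mul_of_nonneg_right (Complex.abs_arg_le_pi _) (abs_nonneg _)
  calc _ ≤ ((1 / y) ^ υ.re * (√(1 / y)) ^ ℓ) * Real.exp (Real.pi * |υ.im|) := by gcongr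
    _ = _ := by ring

/-- The majorant depends on p only through ‖p‖ ≥ y, so it stays valid as p approaches the imaginary
axis. The argument of 1/p costs at most e^{π|Im υ|}, independently of ℓ. -/
theorem norm_gammaTerm_one_div_cpow_le {υ : ℂ} {p : ℂ} {y : ℝ} (hυ : 0 < υ.re) (hy : 0 < y)
    (hp : y ≤ ‖p‖) (a : ℝ) (ℓ : ℕ) :
    ‖gammaTerm υ (fun ℓ => (-1) ^ ℓ * (1 / p) ^ (υ + (ℓ : ℂ) / 2)) a ℓ‖ ≤
      (1 / y) ^ υ.re * Real.exp (Real.pi * |υ.im|) *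
        ‖gammaTerm υ (fun _ => 1) (√(1 / y) * a) ℓ‖ := by
  unfold gammaTerm
  simp only [norm_mul, norm_pow, norm_neg, norm_one, one_pow, one_mul, norm_div, Complex.norm_real,
    Complex.ofReal_mul, mul_pow]
  have := norm_one_div_cpow_le hυ hy hp ℓ
  rw [Real.norm_of_nonneg (Real.sqrt_nonneg _)]
  calc _ ≤ ((1 / y) ^ υ.re * Real.exp (Real.pi * |υ.im|) * (√(1 / y)) ^ ℓ) *
        ‖Complex.Gamma (υ + (ℓ : ℂ) / 2)‖ * (‖a‖ ^ ℓ / ‖(ℓ.factorial : ℂ)‖) := by gcongr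
    _ = _ := by ring

theorem cpow_add_natCast_half {x : ℝ} (hx : 0 < x) (υ : ℂ) (ℓ : ℕ) :
    (x : ℂ) ^ (υ + (ℓ : ℂ) / 2) = (x : ℂ) ^ υ * (√x : ℂ) ^ ℓ := by
  have hx' : (x : ℂ) ≠ 0 := by exact_mod_cast hx.ne'
  rw [Complex.cpow_add _ _ hx', Real.sqrt_eq_rpow, ← Complex.ofReal_pow,
    ← Real.rpow_mul_natCast hx.le, Complex.ofReal_cpow hx.le]
  congr 2; push_cast; ring

theorem hasSum_exp_neg_mul_sqrt {υ p : ℂ} (a : ℝ) {x : ℝ} (hx : 0 < x) :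
    HasSum (fun ℓ : ℕ => (-(a : ℂ)) ^ ℓ / (ℓ.factorial : ℂ) *
        ((x : ℂ) ^ (υ + (ℓ : ℂ) / 2 - 1) * Complex.exp (-(p * x))))
      ((x : ℂ) ^ (υ - 1) * (Real.exp (-a * √x) : ℝ) * Complex.exp (-(p * x))) := by
  have h := (NormedSpace.expSeries_div_hasSum_exp (𝔸 := ℂ) ((-a * √x : ℝ) : ℂ)).mul_left
    ((x : ℂ) ^ (υ - 1) * Complex.exp (-(p * x)))
  rw [← Complex.exp_eq_exp_ℂ, ← Complex.ofReal_exp] at h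
  rw [mul_right_comm]
  refine Eq.subst (motive := fun f => HasSum f _) (funext fun ℓ => ?_) h
  rw [show υ + (ℓ : ℂ) / 2 - 1 = υ - 1 + (ℓ : ℂ) / 2 by ring, cpow_add_natCast_half hx]
  push_cast
  rw [mul_pow]
  ring

theorem integral_cpow_mul_exp_neg_sqrt_mul_exp {υ p : ℂ} (hυ : 0 < υ.re) (hp : 0 < p.re)
    (a : ℝ) :
    ∫ x in Set.Ioi (0 : ℝ),
        (x : ℂ) ^ (υ - 1) * (Real.exp (-a * √x) : ℝ) * Complex.exp (-(p * x)) =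
      gammaSeries υ (fun ℓ => (-1) ^ ℓ * (1 / p) ^ (υ + (ℓ : ℂ) / 2)) a := by
  have hre : ∀ ℓ : ℕ, (υ + (ℓ : ℂ) / 2).re = υ.re + (ℓ : ℝ) / 2 := fun ℓ => by
    rw [show (ℓ : ℂ) / 2 = (((ℓ : ℝ) / 2 : ℝ) : ℂ) by push_cast; ring]
    simp only [Complex.add_re, Complex.ofReal_re]
  have hpos : ∀ ℓ : ℕ, 0 < (υ + (ℓ : ℂ) / 2).re := fun ℓ => by rw [hre]; positivity
  let F : ℕ → ℝ → ℂ := fun ℓ x => (-(a : ℂ)) ^ ℓ / (ℓ.factorial : ℂ) *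
        ((x : ℂ) ^ (υ + (ℓ : ℂ) / 2 - 1) * Complex.exp (-(p * x)))
  have hint : ∀ ℓ, IntegrableOn (F ℓ) (Set.Ioi 0) := fun ℓ =>
    (integrableOn_cpow_mul_exp_neg_mul (hpos ℓ) hp).const_mul _
  -- The integrals of the norms are again terms of a gamma series, at Re υ and with argument a/√(Re
  -- p); this is where Re p > 0 is indispensable.
  have hnorm : ∀ ℓ, ∫ x in Set.Ioi (0 : ℝ), ‖F ℓ x‖ = (1 / p.re) ^ υ.re *
      ‖gammaTerm υ.re (fun _ => 1) (√(1 / p.re) * a) ℓ‖ := fun ℓ => by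
    have e : ∀ x ∈ Set.Ioi (0 : ℝ), ‖F ℓ x‖ = |a| ^ ℓ / ℓ.factorial *
        (x ^ (υ.re + (ℓ : ℝ) / 2 - 1) * Real.exp (-(p.re * x))) := fun x hx => by
      simp only [F]
      rw [norm_mul, norm_cpow_mul_exp_neg_mul hx, hre]
      simp
    rw [setIntegral_congr_fun measurableSet_Ioi e, integral_const_mul,
      Real.integral_rpow_mul_exp_neg_mul_Ioi (by positivity) hp]
    unfold gammaTerm
    have hg : Complex.Gamma ((υ.re : ℂ) + (ℓ : ℂ) / 2) =
        ((Real.Gamma (υ.re + (ℓ : ℝ) / 2) : ℝ) : ℂ) := by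
      rw [← Complex.Gamma_ofReal]; push_cast; rfl
    have hq : 0 < 1 / p.re := by positivity
    have h1 : (1 / p.re) ^ (υ.re + (ℓ : ℝ) / 2) = (1 / p.re) ^ υ.re * (√(1 / p.re)) ^ ℓ := by
      rw [Real.sqrt_eq_rpow, ← Real.rpow_mul_natCast hq.le, ← Real.rpow_add hq]
      congr 1; ring
    rw [hg, h1, one_mul, norm_mul, norm_div, norm_pow, Complex.norm_real, Complex.norm_real,
      Complex.norm_natCast, Real.norm_of_nonneg (Real.Gamma_pos_of_pos (by positivity)).le,
      norm_mul, Real.norm_of_nonneg (Real.sqrt_nonneg _), Real.norm_eq_abs]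
    ring
  have hsum : Summable fun ℓ => ∫ x in Set.Ioi (0 : ℝ), ‖F ℓ x‖ := by
    simp only [hnorm]
    exact (summable_norm_gammaTerm (by simpa using hυ) (M := 1) (fun _ => by simp) _).mul_left _
  have h := hasSum_integral_of_summable_integral_norm hint hsum
  rw [setIntegral_congr_fun measurableSet_Ioi fun x hx =>
    (hasSum_exp_neg_mul_sqrt (υ := υ) (p := p) a hx).tsum_eq.symm, ← h.tsum_eq]
  refine tsum_congr fun ℓ => ?_
  simp only [F]
  rw [integral_const_mul, integral_cpow_mul_exp_neg_complex_mul (hpos ℓ) hp]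
  unfold gammaTerm
  rw [neg_pow]
  ring

/-- The bound is free of p and integrable when a > 0: the decay of e^{-a√x} alone dominates the
limit Re p → 0. -/
theorem norm_cpow_mul_exp_neg_sqrt_mul_exp_le {υ p : ℂ} (hp : 0 ≤ p.re) (a : ℝ) {x : ℝ}
    (hx : 0 < x) :
    ‖(x : ℂ) ^ (υ - 1) * (Real.exp (-a * √x) : ℝ) * Complex.exp (-(p * x))‖ ≤
      x ^ (υ.re - 1) * Real.exp (-a * x ^ (1 / 2 : ℝ)) := by
  rw [mul_right_comm, norm_mul, norm_cpow_mul_exp_neg_mul hx, Complex.norm_real,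
    Real.norm_of_nonneg (Real.exp_pos _).le, Real.sqrt_eq_rpow]
  refine mul_le_mul_of_nonneg_right ?_ (Real.exp_pos _).le
  refine mul_le_of_le_one_right (Real.rpow_nonneg hx.le _) (Real.exp_le_one_iff.2 ?_)
  nlinarith [mul_nonneg hp hx.le]

theorem measurable_cpow_mul_exp_neg_sqrt_mul_exp (υ p : ℂ) (a : ℝ) :
    Measurable fun x : ℝ =>
      (x : ℂ) ^ (υ - 1) * (Real.exp (-a * √x) : ℝ) * Complex.exp (-(p * x)) :=
  ((Complex.measurable_ofReal.pow_const (υ - 1)).mul (by fun_prop)).mul (by fun_prop)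

theorem integrableOn_cpow_mul_exp_neg_sqrt_mul_exp {υ p : ℂ} (hυ : 0 < υ.re) (hp : 0 ≤ p.re)
    {a : ℝ} (ha : 0 < a) :
    IntegrableOn (fun x : ℝ =>
      (x : ℂ) ^ (υ - 1) * (Real.exp (-a * √x) : ℝ) * Complex.exp (-(p * x))) (Set.Ioi 0) :=
  Integrable.mono' (integrableOn_rpow_mul_exp_neg_mul_rpow (p := 1 / 2)
    (by linarith : -1 < υ.re - 1) (by norm_num) ha)
    (measurable_cpow_mul_exp_neg_sqrt_mul_exp υ p a).aestronglyMeasurable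
    ((ae_restrict_mem measurableSet_Ioi).mono fun _ hx =>
      norm_cpow_mul_exp_neg_sqrt_mul_exp_le hp a hx)

theorem integral_cpow_mul_exp_neg_sqrt_mul_exp_imaginary {υ : ℂ} (hυ : 0 < υ.re) {a : ℝ}
    (ha : 0 < a) {η : ℝ} (hη : η ≠ 0) :
    ∫ x in Set.Ioi (0 : ℝ),
        (x : ℂ) ^ (υ - 1) * (Real.exp (-a * √x) : ℝ) * Complex.exp (-((η * Complex.I) * x)) =
      gammaSeries υ (fun ℓ => (-1) ^ ℓ * (1 / (η * Complex.I)) ^ (υ + (ℓ : ℂ) / 2)) a := by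
  -- Approach to iη along ε + iη with ε → 0⁺; both sides of the formula for Re p > 0 converge.
  let P : ℝ → ℂ := fun ε => ε + η * Complex.I
  have hPre : ∀ ε, (P ε).re = ε := fun ε => by simp [P]
  have hPim : ∀ ε, (P ε).im = η := fun ε => by simp [P]
  have hPc : Tendsto P (𝓝[>] 0) (𝓝 (η * Complex.I)) := by
    have : Continuous P := by fun_prop
    have h := (this.tendsto 0).mono_left (nhdsWithin_le_nhds (s := Set.Ioi 0))
    simpa [P] using h
  have hPn : ∀ ε, |η| ≤ ‖P ε‖ := fun ε => by
    simpa [hPim] using Complex.abs_im_le_norm (P ε)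
  have hη' : 0 < |η| := abs_pos.2 hη
  have hI0 : (η : ℂ) * Complex.I ≠ 0 := mul_ne_zero (by exact_mod_cast hη) Complex.I_ne_zero
  have hL : Tendsto (fun ε => ∫ x in Set.Ioi (0 : ℝ),
        (x : ℂ) ^ (υ - 1) * (Real.exp (-a * √x) : ℝ) * Complex.exp (-(P ε * x))) (𝓝[>] 0)
      (𝓝 (∫ x in Set.Ioi (0 : ℝ), (x : ℂ) ^ (υ - 1) * (Real.exp (-a * √x) : ℝ) *
        Complex.exp (-((η * Complex.I) * x)))) := by
    refine tendsto_integral_filter_of_dominated_convergence _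
      (Eventually.of_forall fun ε =>
        (measurable_cpow_mul_exp_neg_sqrt_mul_exp υ (P ε) a).aestronglyMeasurable) ?_
      (integrableOn_rpow_mul_exp_neg_mul_rpow (p := 1 / 2)
        (by linarith : -1 < υ.re - 1) (by norm_num) ha) ?_
    · filter_upwards [self_mem_nhdsWithin] with ε hε
      exact (ae_restrict_mem measurableSet_Ioi).mono fun x hx =>
        norm_cpow_mul_exp_neg_sqrt_mul_exp_le (by rw [hPre]; exact le_of_lt hε) a hx
    · refine Eventually.of_forall fun x => Tendsto.const_mul _ ?_
      exact (Complex.continuous_exp.tendsto _).comp (hPc.mul_const _).neg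
  have hR : Tendsto (fun ε => gammaSeries υ
        (fun ℓ => (-1) ^ ℓ * (1 / P ε) ^ (υ + (ℓ : ℂ) / 2)) a) (𝓝[>] 0)
      (𝓝 (gammaSeries υ (fun ℓ => (-1) ^ ℓ * (1 / (η * Complex.I)) ^ (υ + (ℓ : ℂ) / 2)) a)) := by
    refine tendsto_tsum_of_dominated_convergence
      ((summable_norm_gammaTerm hυ (c := fun _ => 1) (M := 1) (fun _ => by simp)
        (√(1 / |η|) * a)).mul_left _) (fun ℓ => ?_)
      (Eventually.of_forall fun ε ℓ => norm_gammaTerm_one_div_cpow_le hυ hη' (hPn ε) a ℓ)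
    unfold gammaTerm
    refine Tendsto.mul_const _ (Tendsto.mul_const _ (Tendsto.const_mul _ ?_))
    have hinv : Tendsto (fun ε => 1 / P ε) (𝓝[>] 0) (𝓝 (1 / (η * Complex.I))) :=
      tendsto_const_nhds.div hPc hI0
    refine hinv.cpow tendsto_const_nhds ?_
    -- 1/(iη) has nonzero imaginary part, so it avoids the branch cut of the power.
    right
    rw [one_div, Complex.inv_im]
    simp [hη]
  refine tendsto_nhds_unique hL (hR.congr' ?_)
  filter_upwards [self_mem_nhdsWithin] with ε hε
  exact (integral_cpow_mul_exp_neg_sqrt_mul_exp hυ (by rw [hPre]; exact hε) a).symm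

/-! ### The cosine integral as a gamma series -/

theorem one_div_mul_I_cpow {y : ℝ} (hy : 0 < y) (s : ℂ) :
    (1 / ((y : ℂ) * Complex.I)) ^ s =
      (y : ℂ) ^ (-s) * Complex.exp (-(s * Real.pi / 2 * Complex.I)) := by
  have hy' : (y : ℂ) ≠ 0 := by exact_mod_cast hy.ne'
  have e : 1 / ((y : ℂ) * Complex.I) = ((y⁻¹ : ℝ) : ℂ) * -Complex.I := by
    rw [one_div, mul_inv, Complex.inv_I]; push_cast; rfl
  rw [Complex.cpow_def_of_ne_zero hy', Complex.cpow_def_of_ne_zero (by simp [hy']), e,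
    Complex.log_ofReal_mul (inv_pos.2 hy) (by simp), Complex.log_neg_I, ← Complex.exp_add,
    Real.log_inv, ← Complex.ofReal_log hy.le]
  congr 1; push_cast; ring

theorem one_div_neg_mul_I_cpow {y : ℝ} (hy : 0 < y) (s : ℂ) :
    (1 / (((-y : ℝ) : ℂ) * Complex.I)) ^ s =
      (y : ℂ) ^ (-s) * Complex.exp (s * Real.pi / 2 * Complex.I) := by
  have hy' : (y : ℂ) ≠ 0 := by exact_mod_cast hy.ne'
  have e : 1 / (((-y : ℝ) : ℂ) * Complex.I) = ((y⁻¹ : ℝ) : ℂ) * Complex.I := by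
    rw [one_div, mul_inv, Complex.inv_I]; push_cast; rw [inv_neg]; ring
  rw [Complex.cpow_def_of_ne_zero hy', Complex.cpow_def_of_ne_zero (by simp [hy']), e,
    Complex.log_ofReal_mul (inv_pos.2 hy) (by simp), Complex.log_I, ← Complex.exp_add,
    Real.log_inv, ← Complex.ofReal_log hy.le]
  congr 1; push_cast; ring

/-- The coefficients `(-1)^ℓ cos(υπ/2 + ℓπ/4)`. -/
noncomputable def cosCoeff (υ : ℂ) (ℓ : ℕ) : ℂ :=
  (-1) ^ ℓ * Complex.cos (υ * (Real.pi : ℂ) / 2 + (ℓ : ℂ) * (Real.pi : ℂ) / 4)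

theorem cosIntegrand_eq (υ : ℂ) (b c lam y : ℝ) (k : ℕ) (x : ℝ) :
    cosIntegrand υ b c lam y k x =
      ((x : ℂ) ^ (υ - 1) * (Real.exp (-(lam * b + c * k) * √x) : ℝ) *
          Complex.exp (-((y * Complex.I) * x)) +
        (x : ℂ) ^ (υ - 1) * (Real.exp (-(lam * b + c * k) * √x) : ℝ) *
          Complex.exp (-((((-y : ℝ) : ℂ) * Complex.I) * x))) / 2 := by
  unfold cosIntegrand
  rw [Complex.ofReal_cos, Complex.cos]
  push_cast
  rw [show (x : ℂ) * y * Complex.I = -(-(y : ℂ) * Complex.I * x) by ring,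
    show -((x : ℂ) * y) * Complex.I = -((y : ℂ) * Complex.I * x) by ring]
  ring

theorem integrableOn_cosIntegrand {υ : ℂ} (hυ : 0 < υ.re) {b c lam y : ℝ} {k : ℕ}
    (ha : 0 < lam * b + c * k) : IntegrableOn (cosIntegrand υ b c lam y k) (Set.Ioi 0) := by
  rw [funext (cosIntegrand_eq υ b c lam y k)]
  exact ((integrableOn_cpow_mul_exp_neg_sqrt_mul_exp hυ (by simp) ha).add
    (integrableOn_cpow_mul_exp_neg_sqrt_mul_exp hυ (by simp) ha)).div_const 2

theorem integral_cosIntegrand {υ : ℂ} (hυ : 0 < υ.re) {b c lam y : ℝ} (hy : 0 < y) {k : ℕ}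
    (ha : 0 < lam * b + c * k) :
    ∫ x in Set.Ioi (0 : ℝ), cosIntegrand υ b c lam y k x =
      (y : ℂ) ^ (-υ) * gammaSeries υ (cosCoeff υ) ((lam * b + c * k) / √y) := by
  have i1 := integrableOn_cpow_mul_exp_neg_sqrt_mul_exp (p := y * Complex.I) hυ (by simp) ha
  have i2 := integrableOn_cpow_mul_exp_neg_sqrt_mul_exp (p := ((-y : ℝ) : ℂ) * Complex.I) hυ
    (by simp) ha
  rw [funext (cosIntegrand_eq υ b c lam y k), integral_div, integral_add i1 i2,
    integral_cpow_mul_exp_neg_sqrt_mul_exp_imaginary hυ ha hy.ne',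
    integral_cpow_mul_exp_neg_sqrt_mul_exp_imaginary hυ ha (neg_ne_zero.2 hy.ne')]
  have hs : ∀ η : ℝ, y ≤ ‖(η : ℂ) * Complex.I‖ → Summable (gammaTerm υ (fun ℓ =>
      (-1) ^ ℓ * (1 / (η * Complex.I)) ^ (υ + (ℓ : ℂ) / 2)) (lam * b + c * k)) := fun η hη =>
    ((summable_norm_gammaTerm hυ (c := fun _ => 1) (M := 1) (fun _ => by simp) _).mul_left
      _).of_norm_bounded (fun ℓ => norm_gammaTerm_one_div_cpow_le hυ hy hη _ ℓ)
  have n1 : y ≤ ‖(y : ℂ) * Complex.I‖ := by simp [le_abs_self]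
  have n2 : y ≤ ‖((-y : ℝ) : ℂ) * Complex.I‖ := by simp [le_abs_self]
  unfold gammaSeries
  rw [← (hs y n1).tsum_add (hs (-y) n2), ← tsum_div_const, ← tsum_mul_left]
  refine tsum_congr fun ℓ => ?_
  simp only [gammaTerm, cosCoeff]
  -- The phases e^{∓iπs/2} at s = υ + ℓ/2 average to cos(πs/2), and y^{-s} splits into y^{-υ} and
  -- the factor absorbed in r = a/√y.
  have hneg : (y : ℂ) ^ (-(υ + (ℓ : ℂ) / 2)) = (y : ℂ) ^ (-υ) / (√y : ℂ) ^ ℓ := by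
    rw [Complex.cpow_neg, cpow_add_natCast_half hy, Complex.cpow_neg, mul_inv, div_eq_mul_inv]
  rw [one_div_mul_I_cpow hy, one_div_neg_mul_I_cpow hy, hneg, Complex.cos]
  rw [show υ * (Real.pi : ℂ) / 2 + (ℓ : ℂ) * (Real.pi : ℂ) / 4 =
    (υ + (ℓ : ℂ) / 2) * (Real.pi : ℂ) / 2 by ring, Complex.ofReal_div, div_pow, neg_mul]
  ring

/-! ### Splitting modulo four into 2F3 series -/

/-- The indicator of the residue class of `j` modulo four, with alternating signs. -/
noncomputable def residueCoeff (j ℓ : ℕ) : ℂ := if ℓ % 4 = j then (-1) ^ (ℓ / 4) else 0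

theorem norm_residueCoeff_le (j ℓ : ℕ) : ‖residueCoeff j ℓ‖ ≤ 1 := by
  unfold residueCoeff
  split_ifs <;> simp

theorem residueCoeff_add_four (j ℓ : ℕ) : residueCoeff j (ℓ + 4) = -residueCoeff j ℓ := by
  unfold residueCoeff
  rw [Nat.add_mod_right, Nat.add_div_right ℓ (by norm_num), pow_succ]
  split_ifs <;> simp

/-- A sequence with c (ℓ + 4) = -c ℓ is determined by its first four values. -/
theorem eq_sum_residueCoeff {c : ℕ → ℂ} (h4 : ∀ ℓ, c (ℓ + 4) = -c ℓ) (ℓ : ℕ) :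
    c ℓ = ∑ j ∈ Finset.range 4, c j * residueCoeff j ℓ := by
  have hn : ∀ n j, c (j + 4 * n) = (-1) ^ n * c j := by
    intro n j
    induction n with
    | zero => simp
    | succ n ih => rw [show j + 4 * (n + 1) = j + 4 * n + 4 by ring, h4, ih, pow_succ]; ring
  have hℓ : c ℓ = (-1) ^ (ℓ / 4) * c (ℓ % 4) := by
    rw [← hn, Nat.mod_add_div]
  rw [hℓ, Finset.sum_eq_single (ℓ % 4)]
  · simp [residueCoeff, mul_comm]
  · intro j _ hj
    simp [residueCoeff, hj.symm]
  · intro h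
    exact absurd (Finset.mem_range.2 (Nat.mod_lt ℓ (by norm_num))) h

theorem cosCoeff_add_four (υ : ℂ) (ℓ : ℕ) : cosCoeff υ (ℓ + 4) = -cosCoeff υ ℓ := by
  unfold cosCoeff
  rw [show υ * (Real.pi : ℂ) / 2 + ((ℓ + 4 : ℕ) : ℂ) * (Real.pi : ℂ) / 4 =
    υ * (Real.pi : ℂ) / 2 + (ℓ : ℂ) * (Real.pi : ℂ) / 4 + Real.pi by push_cast; ring,
    Complex.cos_add_pi]
  ring

theorem norm_cosCoeff_le (υ : ℂ) (ℓ : ℕ) :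
    ‖cosCoeff υ ℓ‖ ≤ ∑ j ∈ Finset.range 4, ‖cosCoeff υ j‖ := by
  rw [eq_sum_residueCoeff (cosCoeff_add_four υ) ℓ]
  refine (norm_sum_le _ _).trans (Finset.sum_le_sum fun j _ => ?_)
  rw [norm_mul]
  exact mul_le_of_le_one_right (norm_nonneg _) (norm_residueCoeff_le j ℓ)

theorem gammaSeries_cosCoeff {υ : ℂ} (hυ : 0 < υ.re) (r : ℝ) :
    gammaSeries υ (cosCoeff υ) r =
      ∑ j ∈ Finset.range 4, cosCoeff υ j * gammaSeries υ (residueCoeff j) r := by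
  unfold gammaSeries
  simp only [← tsum_mul_left]
  rw [← Summable.tsum_finsetSum fun j _ =>
    ((summable_norm_gammaTerm hυ (norm_residueCoeff_le j) r).of_norm.mul_left (cosCoeff υ j))]
  refine tsum_congr fun ℓ => ?_
  unfold gammaTerm
  rw [eq_sum_residueCoeff (cosCoeff_add_four υ) ℓ, Finset.sum_mul, Finset.sum_mul]
  exact Finset.sum_congr rfl fun j _ => by ring

theorem poch_zero (a : ℂ) : poch a 0 = 1 := by simp [poch]

theorem poch_succ (a : ℂ) (n : ℕ) : poch a (n + 1) = poch a n * (a + n) := by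
  simp [poch, ascPochhammer_succ_eval]

theorem pFqTerm_two_three_succ (a₁ a₂ b₁ b₂ b₃ z : ℂ) (n : ℕ) :
    pFqTerm [a₁, a₂] [b₁, b₂, b₃] z (n + 1) = pFqTerm [a₁, a₂] [b₁, b₂, b₃] z n *
      ((a₁ + n) * (a₂ + n) * z / ((b₁ + n) * (b₂ + n) * (b₃ + n) * (n + 1))) := by
  simp only [pFqTerm, List.map_cons, List.map_nil, List.prod_cons, List.prod_nil, mul_one,
    poch_succ, Nat.factorial_succ, pow_succ, Nat.cast_mul, Nat.cast_add, Nat.cast_one,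
    div_eq_mul_inv, mul_inv]
  ring

/-- Raising n by 1 raises ℓ by 4. Then Γ gains 4(a₁+n)(a₂+n) and the factorial gains
256(b₁+n)(b₂+n)(b₃+n)(n+1), so the argument is -r⁴·4/256 = -r⁴/64. The omitted parameter 4/4
accounts for the factor n+1, that is, for n!. -/
theorem Gamma_mul_pow_div_factorial_eq_pFqTerm {υ : ℂ} (hυ : 0 < υ.re) (r : ℝ) (j : ℕ)
    {b₁ b₂ b₃ : ℂ} (hb : ∀ n : ℕ, (b₁ + n) * (b₂ + n) * (b₃ + n) * (n + 1) =
      ((4 * n + j + 1) * (4 * n + j + 2) * (4 * n + j + 3) * (4 * n + j + 4) : ℕ) / 256) (n : ℕ) :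
    (-1) ^ n * Complex.Gamma (υ + ((j + 4 * n : ℕ) : ℂ) / 2) *
        ((r : ℂ) ^ (j + 4 * n) / ((j + 4 * n).factorial : ℂ)) =
      Complex.Gamma (υ + (j : ℂ) / 2) * ((r : ℂ) ^ j / (j.factorial : ℂ)) *
        pFqTerm [(2 * υ + j) / 4, (2 * υ + j + 2) / 4] [b₁, b₂, b₃] (-(r : ℂ) ^ 4 / 64) n := by
  induction n with
  | zero => simp [pFqTerm, poch_zero]
  | succ n ih =>
    rw [pFqTerm_two_three_succ, ← mul_assoc, ← ih, hb,
      show j + 4 * (n + 1) = j + 4 * n + 2 + 2 by ring, Gamma_add_half_natCast_add_two hυ,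
      Gamma_add_half_natCast_add_two hυ]
    simp only [Nat.factorial_succ]
    have h0 : ((j + 4 * n).factorial : ℂ) ≠ 0 := by exact_mod_cast (Nat.factorial_ne_zero _)
    have h1 : ((j : ℂ) + 4 * n + 1) ≠ 0 := by exact_mod_cast (by omega : j + 4 * n + 1 ≠ 0)
    have h2 : ((j : ℂ) + 4 * n + 2) ≠ 0 := by exact_mod_cast (by omega : j + 4 * n + 2 ≠ 0)
    have h3 : ((j : ℂ) + 4 * n + 3) ≠ 0 := by exact_mod_cast (by omega : j + 4 * n + 3 ≠ 0)
    have h4 : ((j : ℂ) + 4 * n + 4) ≠ 0 := by exact_mod_cast (by omega : j + 4 * n + 4 ≠ 0)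
    have e1 : (((j + 4 * n + 2 + 1 + 1) * ((j + 4 * n + 2 + 1) * ((j + 4 * n + 1 + 1) *
        ((j + 4 * n + 1) * (j + 4 * n).factorial))) : ℕ) : ℂ) =
        ((j : ℂ) + 4 * n + 4) * (((j : ℂ) + 4 * n + 3) * (((j : ℂ) + 4 * n + 2) *
        (((j : ℂ) + 4 * n + 1) * ((j + 4 * n).factorial : ℂ)))) := by push_cast; ring
    have e2 : (((4 * n + j + 1) * (4 * n + j + 2) * (4 * n + j + 3) * (4 * n + j + 4) : ℕ) : ℂ) =
        ((j : ℂ) + 4 * n + 4) * (((j : ℂ) + 4 * n + 3) * (((j : ℂ) + 4 * n + 2) *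
        ((j : ℂ) + 4 * n + 1))) := by push_cast; ring
    rw [e1, e2]
    push_cast
    field_simp
    ring

theorem paramDelta_two (υ : ℂ) (j : ℕ) : paramDelta 2 ((2 * υ + (j : ℂ)) / 2) =
    [(2 * υ + j) / 4, (2 * υ + j + 2) / 4] := by
  have e1 : ((2 * υ + j) / 2 + ((0 : ℕ) : ℂ)) / ((2 : ℕ) : ℂ) = (2 * υ + j) / 4 := by
    push_cast; ring
  have e2 : ((2 * υ + j) / 2 + ((1 : ℕ) : ℂ)) / ((2 : ℕ) : ℂ) = (2 * υ + j + 2) / 4 := by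
    push_cast; ring
  rw [← e1, ← e2]
  rfl

theorem paramDeltaStar_four_one : paramDeltaStar 4 1 = [1 / 4, 1 / 2, 3 / 4] := by
  have : paramDeltaStar 4 1 = [((1 : ℕ) : ℂ) / (4 : ℕ), ((2 : ℕ) : ℂ) / (4 : ℕ),
    ((3 : ℕ) : ℂ) / (4 : ℕ)] := rfl
  rw [this]; norm_num

theorem paramDeltaStar_four_two : paramDeltaStar 4 2 = [1 / 2, 3 / 4, 5 / 4] := by
  have : paramDeltaStar 4 2 = [((2 : ℕ) : ℂ) / (4 : ℕ), ((3 : ℕ) : ℂ) / (4 : ℕ),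
    ((5 : ℕ) : ℂ) / (4 : ℕ)] := rfl
  rw [this]; norm_num

theorem paramDeltaStar_four_three : paramDeltaStar 4 3 = [3 / 4, 5 / 4, 3 / 2] := by
  have : paramDeltaStar 4 3 = [((3 : ℕ) : ℂ) / (4 : ℕ), ((5 : ℕ) : ℂ) / (4 : ℕ),
    ((6 : ℕ) : ℂ) / (4 : ℕ)] := rfl
  rw [this]; norm_num

theorem paramDeltaStar_four_four : paramDeltaStar 4 4 = [5 / 4, 3 / 2, 7 / 4] := by
  have : paramDeltaStar 4 4 = [((5 : ℕ) : ℂ) / (4 : ℕ), ((6 : ℕ) : ℂ) / (4 : ℕ),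
    ((7 : ℕ) : ℂ) / (4 : ℕ)] := rfl
  rw [this]; norm_num

theorem gammaTerm_residueCoeff {υ : ℂ} (hυ : 0 < υ.re) (r : ℝ) {j : ℕ} (hj : j < 4) (n : ℕ) :
    gammaTerm υ (residueCoeff j) r (j + 4 * n) =
      Complex.Gamma (υ + (j : ℂ) / 2) * ((r : ℂ) ^ j / (j.factorial : ℂ)) *
        pFqTerm (paramDelta 2 ((2 * υ + (j : ℂ)) / 2)) (paramDeltaStar 4 (1 + j))
          (-(r : ℂ) ^ 4 / 64) n := by
  have hres : residueCoeff j (j + 4 * n) = (-1) ^ n := by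
    unfold residueCoeff
    rw [if_pos (by omega), show (j + 4 * n) / 4 = n by omega]
  unfold gammaTerm
  rw [hres, paramDelta_two]
  obtain ⟨b₁, b₂, b₃, h, hb⟩ : ∃ b₁ b₂ b₃ : ℂ, paramDeltaStar 4 (1 + j) = [b₁, b₂, b₃] ∧
      ∀ n : ℕ, (b₁ + n) * (b₂ + n) * (b₃ + n) * (n + 1) =
        ((4 * n + j + 1) * (4 * n + j + 2) * (4 * n + j + 3) * (4 * n + j + 4) : ℕ) / 256 := by
    interval_cases j
    · exact ⟨_, _, _, paramDeltaStar_four_one, fun n => by push_cast; ring⟩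
    · exact ⟨_, _, _, paramDeltaStar_four_two, fun n => by push_cast; ring⟩
    · exact ⟨_, _, _, paramDeltaStar_four_three, fun n => by push_cast; ring⟩
    · exact ⟨_, _, _, paramDeltaStar_four_four, fun n => by push_cast; ring⟩
  rw [h]
  exact Gamma_mul_pow_div_factorial_eq_pFqTerm hυ r j hb n

theorem Gamma_add_half_ne_zero {υ : ℂ} (hυ : 0 < υ.re) (j : ℕ) :
    Complex.Gamma (υ + (j : ℂ) / 2) ≠ 0 := by
  refine Complex.Gamma_ne_zero_of_re_pos ?_
  rw [show (j : ℂ) / 2 = (((j : ℝ) / 2 : ℝ) : ℂ) by push_cast; ring, Complex.add_re,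
    Complex.ofReal_re]
  positivity

/-- Up to a constant factor this is a subseries of a summable gamma series; r ≠ 0 keeps that factor
nonzero. -/
theorem summable_pFqTerm_paramDelta {υ : ℂ} (hυ : 0 < υ.re) {r : ℝ} (hr : r ≠ 0) {j : ℕ}
    (hj : j < 4) : Summable (pFqTerm (paramDelta 2 ((2 * υ + (j : ℂ)) / 2))
      (paramDeltaStar 4 (1 + j)) (-(r : ℂ) ^ 4 / 64)) := by
  have hinj : Function.Injective fun n : ℕ => j + 4 * n := fun m n h => by
    simp only at h; omega
  have h := (summable_norm_gammaTerm hυ (norm_residueCoeff_le j) r).of_norm.comp_injective hinj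
  have e : (gammaTerm υ (residueCoeff j) r ∘ fun n : ℕ => j + 4 * n) = _ :=
    funext fun n => gammaTerm_residueCoeff hυ r hj n
  rw [e] at h
  refine (summable_mul_left_iff ?_).1 h
  have : (j.factorial : ℂ) ≠ 0 := by exact_mod_cast j.factorial_ne_zero
  exact mul_ne_zero (Gamma_add_half_ne_zero hυ j)
    (div_ne_zero (pow_ne_zero _ (by exact_mod_cast hr)) this)

theorem gammaSeries_residueCoeff {υ : ℂ} (hυ : 0 < υ.re) (r : ℝ) {j : ℕ} (hj : j < 4) :
    gammaSeries υ (residueCoeff j) r =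
      Complex.Gamma (υ + (j : ℂ) / 2) * ((r : ℂ) ^ j / (j.factorial : ℂ)) *
        pFq (paramDelta 2 ((2 * υ + (j : ℂ)) / 2)) (paramDeltaStar 4 (1 + j))
          (-(r : ℂ) ^ 4 / 64) := by
  have hinj : Function.Injective fun n : ℕ => j + 4 * n := fun m n h => by
    simp only at h; omega
  unfold gammaSeries pFq
  rw [← tsum_mul_left, ← hinj.tsum_eq]
  · exact tsum_congr fun n => gammaTerm_residueCoeff hυ r hj n
  · intro ℓ hℓ
    have : ℓ % 4 = j := by
      by_contra h
      exact hℓ (by simp [gammaTerm, residueCoeff, h])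
    exact ⟨ℓ / 4, by simp only; omega⟩

/-! ### Summation over k -/

/-- At r = s + tk the exponential growth bound is a constant times (e^{Bt})^k, which 1/k! absorbs.
-/
theorem summable_div_factorial_mul_gammaSeries {Θ : ℕ → ℂ} (hΘ : ∃ M : ℝ, ∀ k, ‖Θ k‖ ≤ M)
    {υ : ℂ} (hυ : 0 < υ.re) {d : ℕ → ℂ} {D : ℝ} (hd : ∀ ℓ, ‖d ℓ‖ ≤ D)
    (h4 : ∀ ℓ, d (ℓ + 4) = -d ℓ) {s t : ℝ} (hs : 0 ≤ s) (ht : 0 ≤ t) :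
    Summable fun k : ℕ => Θ k / (k.factorial : ℂ) * gammaSeries υ d (s + t * k) := by
  obtain ⟨M, hM⟩ := hΘ
  obtain ⟨A, B, hA, hAB⟩ := exists_norm_gammaSeries_le hυ hd h4
  refine ((Real.summable_pow_div_factorial (Real.exp (B * t))).mul_left
    (M * (A * Real.exp (B * s)))).of_norm_bounded fun k => ?_
  have h1 := hAB (s + t * k) (by positivity)
  rw [norm_mul, norm_div, Complex.norm_natCast]
  have hM0 : 0 ≤ M := (norm_nonneg _).trans (hM 0)
  calc ‖Θ k‖ / (k.factorial : ℝ) * ‖gammaSeries υ d (s + t * k)‖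
      ≤ M / (k.factorial : ℝ) * (A * Real.exp (B * (s + t * k))) := by
        gcongr
        exact hM k
    _ = _ := by
        rw [show B * (s + t * k) = B * s + k * (B * t) by ring, Real.exp_add, Real.exp_nat_mul]
        ring

/-- With β = λb/c the quotient telescopes: (β+1)_k / (β)_k = (β+k)/β. -/
theorem mul_pochRatio {b c lam : ℝ} (hc : c ≠ 0) (hβ : 0 < lam * b / c) (k : ℕ) :
    ((lam * b : ℝ) : ℂ) * pochRatio b c lam k = ((lam * b + c * k : ℝ) : ℂ) := by
  have hne : ∀ k, poch ((lam * b / c : ℝ) : ℂ) k ≠ 0 := by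
    intro k
    induction k with
    | zero => simp [poch_zero]
    | succ k ih =>
      rw [poch_succ]
      refine mul_ne_zero ih ?_
      exact_mod_cast (by positivity : lam * b / c + k ≠ 0)
  have hc' : (c : ℂ) ≠ 0 := by exact_mod_cast hc
  have key : ((lam * b / c : ℝ) : ℂ) * poch (((lam * b + c) / c : ℝ) : ℂ) k =
      ((lam * b / c : ℝ) + k) * poch ((lam * b / c : ℝ) : ℂ) k := by
    induction k with
    | zero => simp [poch_zero]
    | succ k ih =>
      rw [poch_succ, poch_succ, ← mul_assoc, ih]
      push_cast
      field_simp
      ring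
  have hβ' : ((lam * b : ℝ) : ℂ) = c * ((lam * b / c : ℝ) : ℂ) := by
    push_cast; field_simp
  unfold pochRatio
  rw [hβ', ← mul_div_assoc, mul_assoc, key, ← mul_assoc, mul_div_assoc, div_self (hne k)]
  push_cast
  field_simp

theorem hypArg_eq {b c lam y : ℝ} (hy : 0 < y) {k : ℕ}
    (hρ : ((lam * b : ℝ) : ℂ) * pochRatio b c lam k = ((lam * b + c * k : ℝ) : ℂ)) :
    hypArg b c lam y k = -(((lam * b + c * k) / √y : ℝ) : ℂ) ^ 4 / 64 := by
  have hy2 : (√y : ℂ) ^ 4 = (y : ℂ) ^ 2 := by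
    have : √y ^ 4 = y ^ 2 := by
      rw [show √y ^ 4 = (√y ^ 2) ^ 2 by ring, Real.sq_sqrt hy.le]
    exact_mod_cast this
  have hy' : (y : ℂ) ≠ 0 := by exact_mod_cast hy.ne'
  unfold hypArg
  rw [hρ, Complex.ofReal_div, div_pow, hy2]
  field_simp

theorem ofReal_rpow_natCast_half {y : ℝ} (hy : 0 < y) (ℓ : ℕ) :
    ((y ^ ((ℓ : ℝ) / 2) : ℝ) : ℂ) = (√y : ℂ) ^ ℓ := by
  rw [Real.sqrt_eq_rpow, ← Complex.ofReal_pow, ← Real.rpow_mul_natCast hy.le]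
  congr 2; ring

theorem doubleTerm_eq {υ : ℂ} {b c lam y : ℝ} (hy : 0 < y) (k ℓ : ℕ) :
    doubleTerm υ b c lam y k ℓ = gammaTerm υ (cosCoeff υ) ((lam * b + c * k) / √y) ℓ := by
  unfold doubleTerm gammaTerm cosCoeff
  rw [ofReal_rpow_natCast_half hy, Complex.ofReal_div, div_pow]
  ring

theorem IStarCTerm_eq (Θ : ℕ → ℂ) {υ : ℂ} (hυ : 0 < υ.re) {b c lam y : ℝ} (hy : 0 < y) {k : ℕ}
    (ha : 0 < lam * b + c * k) :
    IStarCTerm Θ υ b c lam y k = (y : ℂ) ^ (-υ) *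
      (Θ k / (k.factorial : ℂ) * gammaSeries υ (cosCoeff υ) ((lam * b + c * k) / √y)) := by
  unfold IStarCTerm
  rw [integral_cosIntegrand hυ hy ha]
  ring

theorem cos_add_pi_div_two_mul (z : ℂ) : Complex.cos (z + 2 * Real.pi / 4) = -Complex.sin z := by
  rw [show z + 2 * (Real.pi : ℂ) / 4 = z + Real.pi / 2 by ring, Complex.cos_add_pi_div_two]

theorem cos_add_three_pi_div_four (z : ℂ) :
    Complex.cos (z + 3 * Real.pi / 4) = -Complex.sin (z + Real.pi / 4) := by
  rw [show z + 3 * (Real.pi : ℂ) / 4 = z + Real.pi / 4 + Real.pi / 2 by ring,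
    Complex.cos_add_pi_div_two]

/-! ### The main theorem -/

theorem mainTheorem1 (Θ : ℕ → ℂ) (hΘ : ∃ M : ℝ, ∀ k, ‖Θ k‖ ≤ M)
    (υ : ℂ) (hυ : 0 < υ.re) (b c lam y : ℝ) (hc : 0 < c) (hy : 0 < y)
    (hlb : (0 < lam ∧ 0 < b) ∨ (lam < 0 ∧ b < 0)) :
    -- the integrals and the series defining `I*_C` converge
    (∀ k : ℕ, MeasureTheory.IntegrableOn (cosIntegrand υ b c lam y k) (Set.Ioi 0)) ∧
    Summable (IStarCTerm Θ υ b c lam y) ∧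
    -- the double (iterated) series converges and represents `I*_C`
    (∀ k : ℕ, Summable (doubleTerm υ b c lam y k)) ∧
    Summable (fun k : ℕ => Θ k / (k.factorial : ℂ) * ∑' ℓ : ℕ, doubleTerm υ b c lam y k ℓ) ∧
    IStarC Θ υ b c lam y =
      (y : ℂ) ^ (-υ) *
        ∑' k : ℕ, Θ k / (k.factorial : ℂ) * ∑' ℓ : ℕ, doubleTerm υ b c lam y k ℓ ∧
    -- the ratio of Pochhammer symbols
    (∀ k : ℕ, ((lam * b : ℝ) : ℂ) * pochRatio b c lam k = ((lam * b + c * k : ℝ) : ℂ)) ∧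
    -- first form with `2F3`
    (∀ k : ℕ, ∀ j ∈ Finset.range 4,
      Summable (pFqTerm (paramDelta 2 ((2 * υ + (j : ℂ)) / 2)) (paramDeltaStar 4 (1 + j))
        (hypArg b c lam y k))) ∧
    Summable (fun k : ℕ => Θ k / (k.factorial : ℂ) * ∑ j ∈ Finset.range 4,
          (-1) ^ j * ((lam * b + c * k : ℝ) : ℂ) ^ j * Complex.Gamma (υ + (j : ℂ) / 2) /
              (((y ^ ((j : ℝ) / 2) : ℝ) : ℂ) * (j.factorial : ℂ)) *
            Complex.cos (υ * (Real.pi : ℂ) / 2 + (j : ℂ) * (Real.pi : ℂ) / 4) *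
            pFq (paramDelta 2 ((2 * υ + (j : ℂ)) / 2)) (paramDeltaStar 4 (1 + j))
              (hypArg b c lam y k)) ∧
    IStarC Θ υ b c lam y =
      (y : ℂ) ^ (-υ) *
        ∑' k : ℕ, Θ k / (k.factorial : ℂ) * ∑ j ∈ Finset.range 4,
          (-1) ^ j * ((lam * b + c * k : ℝ) : ℂ) ^ j * Complex.Gamma (υ + (j : ℂ) / 2) /
              (((y ^ ((j : ℝ) / 2) : ℝ) : ℂ) * (j.factorial : ℂ)) *
            Complex.cos (υ * (Real.pi : ℂ) / 2 + (j : ℂ) * (Real.pi : ℂ) / 4) *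
            pFq (paramDelta 2 ((2 * υ + (j : ℂ)) / 2)) (paramDeltaStar 4 (1 + j))
              (hypArg b c lam y k) ∧
    -- second form with `2F3`, the powers written through the ratios of Pochhammer symbols
    Summable (fun k : ℕ => Θ k / (k.factorial : ℂ) * ∑ j ∈ Finset.range 4,
          (-1) ^ j * Complex.Gamma (υ + (j : ℂ) / 2) / (j.factorial : ℂ) *
            Complex.cos (υ * (Real.pi : ℂ) / 2 + (j : ℂ) * (Real.pi : ℂ) / 4) *
            ((lam * b / √y : ℝ) : ℂ) ^ j * pochRatio b c lam k ^ j *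
            pFq (paramDelta 2 ((2 * υ + (j : ℂ)) / 2)) (paramDeltaStar 4 (1 + j))
              (hypArg b c lam y k)) ∧
    IStarC Θ υ b c lam y =
      (y : ℂ) ^ (-υ) *
        ∑' k : ℕ, Θ k / (k.factorial : ℂ) * ∑ j ∈ Finset.range 4,
          (-1) ^ j * Complex.Gamma (υ + (j : ℂ) / 2) / (j.factorial : ℂ) *
            Complex.cos (υ * (Real.pi : ℂ) / 2 + (j : ℂ) * (Real.pi : ℂ) / 4) *
            ((lam * b / √y : ℝ) : ℂ) ^ j * pochRatio b c lam k ^ j *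
            pFq (paramDelta 2 ((2 * υ + (j : ℂ)) / 2)) (paramDeltaStar 4 (1 + j))
              (hypArg b c lam y k) ∧
    -- the four separate `k`-series converge and represent `I*_C`
    Summable (fun k : ℕ => Θ k / (k.factorial : ℂ) *
      pFq [υ / 2, (υ + 1) / 2] [1 / 4, 1 / 2, 3 / 4] (hypArg b c lam y k)) ∧
    Summable (fun k : ℕ => Θ k / (k.factorial : ℂ) * pochRatio b c lam k *
      pFq [(2 * υ + 1) / 4, (2 * υ + 3) / 4] [1 / 2, 3 / 4, 5 / 4] (hypArg b c lam y k)) ∧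
    Summable (fun k : ℕ => Θ k / (k.factorial : ℂ) * pochRatio b c lam k ^ 2 *
      pFq [(υ + 1) / 2, (υ + 2) / 2] [3 / 4, 5 / 4, 3 / 2] (hypArg b c lam y k)) ∧
    Summable (fun k : ℕ => Θ k / (k.factorial : ℂ) * pochRatio b c lam k ^ 3 *
      pFq [(2 * υ + 3) / 4, (2 * υ + 5) / 4] [5 / 4, 3 / 2, 7 / 4] (hypArg b c lam y k)) ∧
    IStarC Θ υ b c lam y =
      Complex.Gamma υ * Complex.cos (υ * (Real.pi : ℂ) / 2) / (y : ℂ) ^ υ *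
        (∑' k : ℕ, Θ k / (k.factorial : ℂ) *
          pFq [υ / 2, (υ + 1) / 2] [1 / 4, 1 / 2, 3 / 4] (hypArg b c lam y k))
      - ((lam * b : ℝ) : ℂ) * Complex.Gamma (υ + 1 / 2) *
          Complex.cos (υ * (Real.pi : ℂ) / 2 + (Real.pi : ℂ) / 4) / (y : ℂ) ^ (υ + 1 / 2) *
        (∑' k : ℕ, Θ k / (k.factorial : ℂ) * pochRatio b c lam k *
          pFq [(2 * υ + 1) / 4, (2 * υ + 3) / 4] [1 / 2, 3 / 4, 5 / 4] (hypArg b c lam y k))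
      - ((lam * b : ℝ) : ℂ) ^ 2 * Complex.Gamma (υ + 1) *
          Complex.sin (υ * (Real.pi : ℂ) / 2) / (2 * (y : ℂ) ^ (υ + 1)) *
        (∑' k : ℕ, Θ k / (k.factorial : ℂ) * pochRatio b c lam k ^ 2 *
          pFq [(υ + 1) / 2, (υ + 2) / 2] [3 / 4, 5 / 4, 3 / 2] (hypArg b c lam y k))
      + ((lam * b : ℝ) : ℂ) ^ 3 * Complex.Gamma (υ + 3 / 2) *
          Complex.sin (υ * (Real.pi : ℂ) / 2 + (Real.pi : ℂ) / 4) /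
            (6 * (y : ℂ) ^ (υ + 3 / 2)) *
        (∑' k : ℕ, Θ k / (k.factorial : ℂ) * pochRatio b c lam k ^ 3 *
          pFq [(2 * υ + 3) / 4, (2 * υ + 5) / 4] [5 / 4, 3 / 2, 7 / 4]
            (hypArg b c lam y k)) := by
  have hlb' : 0 < lam * b := by
    rcases hlb with ⟨h1, h2⟩ | ⟨h1, h2⟩
    · exact mul_pos h1 h2
    · exact mul_pos_of_neg_of_neg h1 h2
  have hsy : 0 < √y := Real.sqrt_pos.2 hy
  have ha : ∀ k : ℕ, 0 < lam * b + c * k := fun k => by positivity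
  have hρ := fun k => mul_pochRatio hc.ne' (div_pos hlb' hc) k
  have hz := fun k => hypArg_eq hy (hρ k)
  have hr : ∀ k : ℕ, (lam * b + c * k) / √y = lam * b / √y + c / √y * k := fun k => by ring
  have hdouble : ∀ k, doubleTerm υ b c lam y k =
      gammaTerm υ (cosCoeff υ) ((lam * b + c * k) / √y) :=
    fun k => funext fun ℓ => doubleTerm_eq hy k ℓ
  -- Stated for every bounded antiperiodic d, since it serves both the full cosine series and each
  -- residue class. For complex series, `Summable` amounts to absolute convergence.
  have hsum : ∀ {d : ℕ → ℂ} {D : ℝ}, (∀ ℓ, ‖d ℓ‖ ≤ D) → (∀ ℓ, d (ℓ + 4) = -d ℓ) →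
      Summable fun k : ℕ => Θ k / (k.factorial : ℂ) *
        gammaSeries υ d ((lam * b + c * k) / √y) := fun hd h4 => by
    simp only [hr]
    exact summable_div_factorial_mul_gammaSeries hΘ hυ hd h4 (by positivity) (by positivity)
  have hcos := hsum (norm_cosCoeff_le υ) (cosCoeff_add_four υ)
  have hI : IStarC Θ υ b c lam y = (y : ℂ) ^ (-υ) * ∑' k : ℕ, Θ k / (k.factorial : ℂ) *
      gammaSeries υ (cosCoeff υ) ((lam * b + c * k) / √y) := by
    unfold IStarC
    rw [← tsum_mul_left]
    exact tsum_congr fun k => IStarCTerm_eq Θ hυ hy (ha k)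
  have hA : ∀ k : ℕ, ∑' ℓ, doubleTerm υ b c lam y k ℓ =
      gammaSeries υ (cosCoeff υ) ((lam * b + c * k) / √y) := fun k => by rw [hdouble]; rfl
  have hρr : ∀ k : ℕ, (((lam * b + c * k) / √y : ℝ) : ℂ) =
      ((lam * b / √y : ℝ) : ℂ) * pochRatio b c lam k := fun k => by
    rw [Complex.ofReal_div, ← hρ k, Complex.ofReal_div]; ring
  have hC : ∀ k : ℕ, ∑ j ∈ Finset.range 4,
      (-1) ^ j * Complex.Gamma (υ + (j : ℂ) / 2) / (j.factorial : ℂ) *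
            Complex.cos (υ * (Real.pi : ℂ) / 2 + (j : ℂ) * (Real.pi : ℂ) / 4) *
            ((lam * b / √y : ℝ) : ℂ) ^ j * pochRatio b c lam k ^ j *
            pFq (paramDelta 2 ((2 * υ + (j : ℂ)) / 2)) (paramDeltaStar 4 (1 + j))
              (hypArg b c lam y k) =
      gammaSeries υ (cosCoeff υ) ((lam * b + c * k) / √y) := fun k => by
    rw [gammaSeries_cosCoeff hυ]
    refine Finset.sum_congr rfl fun j hj => ?_
    rw [gammaSeries_residueCoeff hυ _ (Finset.mem_range.1 hj), hz, hρr, mul_pow]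
    unfold cosCoeff
    ring
  have hB : ∀ k : ℕ, ∑ j ∈ Finset.range 4,
          (-1) ^ j * ((lam * b + c * k : ℝ) : ℂ) ^ j * Complex.Gamma (υ + (j : ℂ) / 2) /
              (((y ^ ((j : ℝ) / 2) : ℝ) : ℂ) * (j.factorial : ℂ)) *
            Complex.cos (υ * (Real.pi : ℂ) / 2 + (j : ℂ) * (Real.pi : ℂ) / 4) *
            pFq (paramDelta 2 ((2 * υ + (j : ℂ)) / 2)) (paramDeltaStar 4 (1 + j))
              (hypArg b c lam y k) =
      gammaSeries υ (cosCoeff υ) ((lam * b + c * k) / √y) := fun k => by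
    rw [gammaSeries_cosCoeff hυ]
    refine Finset.sum_congr rfl fun j hj => ?_
    rw [gammaSeries_residueCoeff hυ _ (Finset.mem_range.1 hj), hz, ofReal_rpow_natCast_half hy,
      Complex.ofReal_div, div_pow]
    unfold cosCoeff
    ring
  have hq : ((lam * b / √y : ℝ) : ℂ) ≠ 0 := by exact_mod_cast (by positivity)
  have hterm : ∀ j : ℕ, j < 4 → ∀ k : ℕ, Θ k / (k.factorial : ℂ) *
        gammaSeries υ (residueCoeff j) ((lam * b + c * k) / √y) =
      Complex.Gamma (υ + (j : ℂ) / 2) * (((lam * b / √y : ℝ) : ℂ) ^ j / (j.factorial : ℂ)) *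
        (Θ k / (k.factorial : ℂ) * pochRatio b c lam k ^ j *
          pFq (paramDelta 2 ((2 * υ + (j : ℂ)) / 2)) (paramDeltaStar 4 (1 + j))
            (hypArg b c lam y k)) := fun j hj k => by
    rw [gammaSeries_residueCoeff hυ _ hj, hz, hρr, mul_pow]
    ring
  have hres := fun j => hsum (norm_residueCoeff_le j) (residueCoeff_add_four j)
  have hS : ∀ j : ℕ, j < 4 → Summable fun k : ℕ => Θ k / (k.factorial : ℂ) * pochRatio b c lam k ^ j *
      pFq (paramDelta 2 ((2 * υ + (j : ℂ)) / 2)) (paramDeltaStar 4 (1 + j))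
        (hypArg b c lam y k) := fun j hj => by
    have h := hres j
    simp only [hterm j hj] at h
    -- The prefactor does not depend on k and is nonzero, as Γ has no zeros and λb ≠ 0, so it can be
    -- cancelled.
    refine (summable_mul_left_iff ?_).1 h
    have : (j.factorial : ℂ) ≠ 0 := by exact_mod_cast j.factorial_ne_zero
    exact mul_ne_zero (Gamma_add_half_ne_zero hυ j) (div_ne_zero (pow_ne_zero _ hq) this)
  have hfinal : IStarC Θ υ b c lam y = (y : ℂ) ^ (-υ) * ∑ j ∈ Finset.range 4, cosCoeff υ j *
      (Complex.Gamma (υ + (j : ℂ) / 2) * (((lam * b / √y : ℝ) : ℂ) ^ j / (j.factorial : ℂ)) *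
        ∑' k : ℕ, Θ k / (k.factorial : ℂ) * pochRatio b c lam k ^ j *
          pFq (paramDelta 2 ((2 * υ + (j : ℂ)) / 2)) (paramDeltaStar 4 (1 + j))
            (hypArg b c lam y k)) := by
    rw [hI]
    congr 1
    have e : ∀ j ∈ Finset.range 4, cosCoeff υ j *
      (Complex.Gamma (υ + (j : ℂ) / 2) * (((lam * b / √y : ℝ) : ℂ) ^ j / (j.factorial : ℂ)) *
        ∑' k : ℕ, Θ k / (k.factorial : ℂ) * pochRatio b c lam k ^ j *
          pFq (paramDelta 2 ((2 * υ + (j : ℂ)) / 2)) (paramDeltaStar 4 (1 + j))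
            (hypArg b c lam y k)) = ∑' k : ℕ, cosCoeff υ j * (Θ k / (k.factorial : ℂ) *
        gammaSeries υ (residueCoeff j) ((lam * b + c * k) / √y)) := fun j hj => by
      rw [← tsum_mul_left, ← tsum_mul_left]
      exact tsum_congr fun k => by rw [hterm j (Finset.mem_range.1 hj)]
    -- Exchanging the sum over j with the sum over k requires each of the four k-series to converge
    -- on its own.
    rw [Finset.sum_congr rfl e, ← Summable.tsum_finsetSum fun j _ => (hres j).mul_left _]
    refine tsum_congr fun k => ?_
    rw [gammaSeries_cosCoeff hυ, Finset.mul_sum]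
    exact Finset.sum_congr rfl fun j _ => by ring
  have p0 : paramDelta 2 ((2 * υ + ((0 : ℕ) : ℂ)) / 2) = [υ / 2, (υ + 1) / 2] := by
    rw [paramDelta_two]; push_cast; congr 1
    · ring
    · congr 1; ring
  have p1 : paramDelta 2 ((2 * υ + ((1 : ℕ) : ℂ)) / 2) = [(2 * υ + 1) / 4, (2 * υ + 3) / 4] := by
    rw [paramDelta_two]; push_cast; congr 2; ring
  have p2 : paramDelta 2 ((2 * υ + ((2 : ℕ) : ℂ)) / 2) = [(υ + 1) / 2, (υ + 2) / 2] := by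
    rw [paramDelta_two]; push_cast; congr 1
    · ring
    · congr 1; ring
  have p3 : paramDelta 2 ((2 * υ + ((3 : ℕ) : ℂ)) / 2) = [(2 * υ + 3) / 4, (2 * υ + 5) / 4] := by
    rw [paramDelta_two]; push_cast; congr 2; ring
  have s0 := hS 0 (by norm_num)
  have s1 := hS 1 (by norm_num)
  have s2 := hS 2 (by norm_num)
  have s3 := hS 3 (by norm_num)
  rw [p0, show 1 + 0 = 1 from rfl, paramDeltaStar_four_one] at s0
  rw [p1, show 1 + 1 = 2 from rfl, paramDeltaStar_four_two] at s1
  rw [p2, show 1 + 2 = 3 from rfl, paramDeltaStar_four_three] at s2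
  rw [p3, show 1 + 3 = 4 from rfl, paramDeltaStar_four_four] at s3
  simp only [pow_zero, pow_one, mul_one] at s0 s1
  refine ⟨fun k => integrableOn_cosIntegrand hυ (ha k), ?_, fun k => ?_, ?_, ?_, hρ,
    fun k j hj => ?_, ?_, ?_, ?_, ?_, s0, s1, s2, s3, ?_⟩
  · exact (hcos.mul_left _).congr fun k => (IStarCTerm_eq Θ hυ hy (ha k)).symm
  · rw [hdouble]
    exact (summable_norm_gammaTerm hυ (norm_cosCoeff_le υ) _).of_norm
  · simp only [hA]; exact hcos
  · simp only [hA]; exact hI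
  · rw [hz]
    exact summable_pFqTerm_paramDelta hυ (div_pos (ha k) hsy).ne' (Finset.mem_range.1 hj)
  · simp only [hB]; exact hcos
  · simp only [hB]; exact hI
  · simp only [hC]; exact hcos
  · simp only [hC]; exact hI
  · have hy' : (y : ℂ) ≠ 0 := by exact_mod_cast hy.ne'
    have hs' : (√y : ℂ) ≠ 0 := by exact_mod_cast hsy.ne'
    have hyυ : (y : ℂ) ^ υ ≠ 0 := by simp [Complex.cpow_eq_zero_iff, hy']
    have y1 : (y : ℂ) ^ (υ + 1 / 2) = (y : ℂ) ^ υ * √y := by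
      simpa using cpow_add_natCast_half hy υ 1
    have y2 : (y : ℂ) ^ (υ + 1) = (y : ℂ) ^ υ * (√y : ℂ) ^ 2 := by
      simpa using cpow_add_natCast_half hy υ 2
    have y3 : (y : ℂ) ^ (υ + 3 / 2) = (y : ℂ) ^ υ * (√y : ℂ) ^ 3 := by
      simpa using cpow_add_natCast_half hy υ 3
    rw [hfinal, y1, y2, y3, Complex.cpow_neg]
    simp only [Finset.sum_range_succ, Finset.sum_range_zero, zero_add, p0, p1, p2, p3,
      show 1 + 0 = 1 from rfl, show 1 + 1 = 2 from rfl, show 1 + 2 = 3 from rfl,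
      show 1 + 3 = 4 from rfl, paramDeltaStar_four_one, paramDeltaStar_four_two,
      paramDeltaStar_four_three, paramDeltaStar_four_four, pow_zero, pow_one, mul_one]
    unfold cosCoeff
    simp only [Nat.cast_ofNat, Nat.cast_one, Nat.cast_zero, cos_add_pi_div_two_mul,
      cos_add_three_pi_div_four, Complex.ofReal_div, zero_div, zero_mul, add_zero, one_mul,
      div_self (two_ne_zero (α := ℂ)), Nat.factorial_zero, Nat.factorial_one,
      show Nat.factorial 2 = 2 from rfl, show Nat.factorial 3 = 6 from rfl, pow_zero, pow_one]
    field_simp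
    ring
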